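/- Let $k$ be an algebraically closed field of characteristic zero and let $\mathcal X=(X_1,X_2,\mu,\partial)$ be a finite crossed module: $X_1,X_2$ are finite groups, $X_1$ acts on $X_2$ from the right by group automorphisms, $(m,g)\mapsto m^g$, and $\partial:X_2\to X_1$ is a group homomorphism with $\partial(m^g)=g^{-1}(\partial m)g$ and $m^{\partial n}=n^{-1}mn$ for all $m,n\in X_2$, $g\in X_1$. Let $\mathcal M(\mathcal X)$ be the category whose objects are triples $(V,P,Q)$, where $V=\bigoplus_{m\in X_2}V_m$ is a finite-dimensional $X_2$-graded $k$-vector space with projections $P(m)$ onto $V_m$, and $Q$ is a linear action of $X_1$ on $V$ with $P(m)Q(g)=Q(g)P(m^g)$; morphisms are the linear maps preserving the grading and the action. It is a ribbon category as follows. The tensor product is that of vector spaces, with $(V\otimes W)_m=\bigoplus_{nl=m}V_n\otimes W_l$ and the diagonal action; the unit $\mathbf 1$ is $k$ in degree $e$ with the trivial action; the braiding is $R_{V,W}(v\otimes w)=\sum_{m\in X_2}Q_W(\partial m)w\otimes P_V(m)v$; the dual $V^*$ has $(V^*)_m=(V_{m^{-1}})^*$ and $Q^*(g)=Q(g^{-1})^*$,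 with the usual evaluation and coevaluation; the twist is $\theta_V=\sum_{m\in X_2}P(m)Q(\partial m)$. Let $\mathrm{tr}$ be the trace of this ribbon category (with values in $\mathrm{End}(\mathbf 1)=k$), let $\dim V=\mathrm{tr}(\mathrm{id}_V)$, and let $s_{VW}=\mathrm{tr}(R_{W,V}\circ R_{V,W})$. An object $V$ is transparent if $R_{W,V}=R_{V,W}^{-1}$ for all objects $W$. Let $\Lambda$ be the set of isomorphism classes of simple objects, $d_p=\dim p$ for $p\in\Lambda$, let $T\subseteq\Lambda$ be the set of isomorphism classes of simple transparent objects, and let $M=\{p\in\Lambda : s_{pq}=d_p\,d_q\text{ for all }q\in\Lambda\}$. Then: (i) $M=T$; moreover, $T$ is also the set of those $p\in\Lambda$ for which the row $(s_{pq})_{q\in\Lambda}$ is a scalar multiple of the row $(s_{\mathbf 1q})_{q\in\Lambda}$ of the unit. (ii) $\theta_V=\mathrm{id}_V$ for every (not necessarily simple) transparent object $V$. (iii) The set $T$ is finite, and $\sum_{p\in T}d_p^2=|\ker\partial|\cdot|\mathrm{coker}\,\partial|$ in $k$, where $\mathrm{coker}\,\partial=X_1/\mathrm{Im}\,\partial$.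 -/

import Mathlib

open CategoryTheory MonoidalCategory
open scoped TensorProduct

universe u v v₁ v₂

/-! ### Ribbon categories, traces, S-matrix, transparent objects -/

/-- A ribbon category: a braided category with duals together with a twist, i.e. a natural family of
automorphisms `θ_X` with `θ_{X ⊗ Y} = R_{Y,X} ∘ R_{X,Y} ∘ (θ_X ⊗ θ_Y)` and `θ_{X*} = (θ_X)*`.
Here `Xᘁ` is the dual `X*` of `X`, with `1 ⟶ X ⊗ X*` and `X* ⊗ X ⟶ 1`. -/
class RibbonCategory (C : Type u) [Category.{v} C] [MonoidalCategory C] [BraidedCategory C]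
    [RightRigidCategory C] where
  /-- The twist. -/
  twist (X : C) : X ≅ X
  twist_naturality {X Y : C} (f : X ⟶ Y) : f ≫ (twist Y).hom = (twist X).hom ≫ f
  twist_tensor (X Y : C) : (twist (X ⊗ Y)).hom =
    ((twist X).hom ⊗ₘ (twist Y).hom) ≫ (β_ X Y).hom ≫ (β_ Y X).hom
  twist_dual (X : C) : (twist (Xᘁ)).hom = ((twist X).hom)ᘁ

namespace RibbonCategory

variable {C : Type u} [Category.{v} C] [MonoidalCategory C] [BraidedCategory C]

/-- `X` is transparent if `R_{Y,X} = R_{X,Y}⁻¹` for all objects `Y`. -/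
def IsTransparent (X : C) : Prop := ∀ Y : C, (β_ Y X).hom = (β_ X Y).inv

variable [RightRigidCategory C] [RibbonCategory C]

/-- The trace in a ribbon category of an endomorphism `f : X ⟶ X`:
the composite `1 ⟶ X ⊗ X* ⟶ X ⊗ X* ⟶ X* ⊗ X ⟶ 1` of the coevaluation, `(θ_X ∘ f) ⊗ id`,
the braiding and the evaluation. -/
def trace {X : C} (f : X ⟶ X) : 𝟙_ C ⟶ 𝟙_ C :=
  η_ X (Xᘁ) ≫ ((f ≫ (twist X).hom) ▷ Xᘁ) ≫ (β_ X (Xᘁ)).hom ≫ ε_ X (Xᘁ)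

end RibbonCategory

/-! ### Crossed modules and their representations -/

/-- A crossed module: groups `X₁`, `X₂`, a right action `m ^ g = act m g` of `X₁` on `X₂` by group
automorphisms and a boundary map `∂ : X₂ → X₁`. -/
structure CrossedModule (X₁ : Type v₁) (X₂ : Type v₂) [Group X₁] [Group X₂] where
  /-- The right action `m ^ g`. -/
  act : X₂ → X₁ → X₂
  act_one : ∀ m, act m 1 = m
  act_mul : ∀ m g h, act m (g * h) = act (act m g) h
  mul_act : ∀ m n g, act (m * n) g = act m g * act n g
  /-- The boundary map `∂`. -/
  bdry : X₂ →* X₁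
  bdry_act : ∀ m g, bdry (act m g) = g⁻¹ * bdry m * g
  act_bdry : ∀ m n, act m (bdry n) = n⁻¹ * m * n

/-- An object `(V, P, Q)` of the category `M(X)`: a finite-dimensional `X₂`-graded vector space with
an action `Q` of `X₁` such that `P(m) Q(g) = Q(g) P(m ^ g)`. The grading is given by the projections
`P(m)` onto the homogeneous components. -/
structure XRep (k : Type u) [Field k] {X₁ : Type v₁} {X₂ : Type v₂} [Group X₁] [Group X₂]
    [Fintype X₂] (X : CrossedModule X₁ X₂) where
  /-- The underlying vector space. -/
  V : Type u
  [addCommGroup : AddCommGroup V]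
  [module : Module k V]
  [finite : Module.Finite k V]
  /-- The projections onto the graded components. -/
  P : X₂ → Module.End k V
  /-- The group action. -/
  Q : X₁ →* Module.End k V
  P_mul_self : ∀ m, P m * P m = P m
  P_mul_of_ne : ∀ m n, m ≠ n → P m * P n = 0
  sum_P : ∑ m, P m = 1
  P_mul_Q : ∀ m g, P m * Q g = Q g * P (X.act m g)

attribute [instance] XRep.addCommGroup XRep.module XRep.finite

namespace XRep

variable {k : Type u} [Field k] {X₁ : Type v₁} {X₂ : Type v₂} [Group X₁] [Group X₂]
  [Fintype X₂] {X : CrossedModule X₁ X₂}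

/-- Morphisms of `M(X)`: linear maps that preserve the grading and the action. -/
@[ext]
structure Hom (V W : XRep k X) where
  /-- The underlying linear map. -/
  lin : V.V →ₗ[k] W.V
  map_P : ∀ m v, lin (V.P m v) = W.P m (lin v)
  map_Q : ∀ g v, lin (V.Q g v) = W.Q g (lin v)

instance : Category (XRep k X) where
  Hom V W := Hom V W
  id V := ⟨LinearMap.id, fun _ _ => rfl, fun _ _ => rfl⟩
  comp f g := ⟨g.lin ∘ₗ f.lin, fun m v => by simp [f.map_P, g.map_P],
    fun m v => by simp [f.map_Q, g.map_Q]⟩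

@[ext]
theorem hom_ext {V W : XRep k X} {f g : V ⟶ W} (h : f.lin = g.lin) : f = g := Hom.ext h

@[simp] theorem id_lin (V : XRep k X) : Hom.lin (𝟙 V) = LinearMap.id := rfl

@[simp] theorem comp_lin {U V W : XRep k X} (f : U ⟶ V) (g : V ⟶ W) :
    (f ≫ g).lin = g.lin ∘ₗ f.lin := rfl

/-- An isomorphism from mutually inverse morphisms. -/
def mkIso {V W : XRep k X} (f : V ⟶ W) (g : W ⟶ V) (h₁ : ∀ v, g.lin (f.lin v) = v)
    (h₂ : ∀ v, f.lin (g.lin v) = v) : V ≅ W where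
  hom := f
  inv := g
  hom_inv_id := hom_ext (LinearMap.ext h₁)
  inv_hom_id := hom_ext (LinearMap.ext h₂)

/-! #### Linear structure -/

section Preadditive

variable {V W : XRep k X}

instance : Zero (V ⟶ W) := ⟨⟨0, by simp, by simp⟩⟩

instance : Add (V ⟶ W) :=
  ⟨fun f g => ⟨f.lin + g.lin, by simp [f.map_P, g.map_P], by simp [f.map_Q, g.map_Q]⟩⟩

instance : Neg (V ⟶ W) :=
  ⟨fun f => ⟨-f.lin, by simp [f.map_P], by simp [f.map_Q]⟩⟩

instance : SMul k (V ⟶ W) :=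
  ⟨fun c f => ⟨c • f.lin, by simp [f.map_P], by simp [f.map_Q]⟩⟩

@[simp] theorem zero_lin : (0 : V ⟶ W).lin = 0 := rfl
@[simp] theorem add_lin (f g : V ⟶ W) : (f + g).lin = f.lin + g.lin := rfl
@[simp] theorem neg_lin (f : V ⟶ W) : (-f).lin = -f.lin := rfl
@[simp] theorem smul_lin (c : k) (f : V ⟶ W) : (c • f).lin = c • f.lin := rfl

instance : AddCommGroup (V ⟶ W) where
  add_assoc f g h := by ext; simp [add_assoc]
  zero_add f := by ext; simp
  add_zero f := by ext; simp
  neg_add_cancel f := by ext; simp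
  add_comm f g := by ext; simp [add_comm]
  nsmul := nsmulRec
  zsmul := zsmulRec

instance : Module k (V ⟶ W) where
  one_smul f := by ext; simp
  mul_smul a b f := by ext; simp [mul_smul]
  smul_zero a := by ext; simp
  smul_add a f g := by ext; simp
  add_smul a b f := by ext; simp [add_smul]
  zero_smul f := by ext; simp

end Preadditive

instance : Preadditive (XRep k X) where
  add_comp _ _ _ _ _ _ := by ext; simp
  comp_add _ _ _ _ _ _ := by ext; simp

instance : Linear k (XRep k X) where
  smul_comp _ _ _ _ _ _ := by ext; simp
  comp_smul _ _ _ _ _ _ := by ext; simp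

/-! #### Homogeneous elements -/

theorem P_P_of_ne (V : XRep k X) {m n : X₂} (h : m ≠ n) (v : V.V) : V.P m (V.P n v) = 0 :=
  LinearMap.congr_fun (V.P_mul_of_ne m n h) v

@[simp] theorem P_P_self (V : XRep k X) (m : X₂) (v : V.V) : V.P m (V.P m v) = V.P m v :=
  LinearMap.congr_fun (V.P_mul_self m) v

theorem sum_P_apply (V : XRep k X) (v : V.V) : ∑ m, V.P m v = v := by
  have := LinearMap.congr_fun V.sum_P v
  simpa using this

theorem P_Q (V : XRep k X) (m : X₂) (g : X₁) (v : V.V) :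
    V.P m (V.Q g v) = V.Q g (V.P (X.act m g) v) :=
  LinearMap.congr_fun (V.P_mul_Q m g) v

theorem Q_mul (V : XRep k X) (g h : X₁) (v : V.V) : V.Q g (V.Q h v) = V.Q (g * h) v := by
  simp

theorem P_eq_zero (V : XRep k X) {m n : X₂} {v : V.V} (hv : V.P n v = v) (h : m ≠ n) :
    V.P m v = 0 := by
  rw [← hv, V.P_P_of_ne h]

/-- `Q(g)` maps the component of degree `m` to the one of degree `m ^ g⁻¹`. -/
theorem Q_homog (V : XRep k X) {m : X₂} {v : V.V} (hv : V.P m v = v) (g : X₁) :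
    V.P (X.act m g⁻¹) (V.Q g v) = V.Q g v := by
  rw [P_Q, ← X.act_mul]; simp [X.act_one, hv]

theorem Q_bdry_homog (V : XRep k X) {m : X₂} {v : V.V} (hv : V.P m v = v) (n : X₂) :
    V.P (n * m * n⁻¹) (V.Q (X.bdry n) v) = V.Q (X.bdry n) v := by
  have := V.Q_homog hv (X.bdry n)
  rwa [← map_inv, X.act_bdry, inv_inv] at this

theorem linearMap_ext (V : XRep k X) {M : Type*} [AddCommGroup M] [Module k M]
    {f g : V.V →ₗ[k] M} (h : ∀ m v, V.P m v = v → f v = g v) : f = g := by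
  ext v
  rw [← V.sum_P_apply v, map_sum, map_sum]
  exact Finset.sum_congr rfl fun m _ => h m _ (V.P_P_self m v)

theorem tensor_ext (V W : XRep k X) {M : Type*} [AddCommGroup M] [Module k M]
    {f g : V.V ⊗[k] W.V →ₗ[k] M}
    (h : ∀ m n v w, V.P m v = v → W.P n w = w → f (v ⊗ₜ w) = g (v ⊗ₜ w)) : f = g := by
  apply TensorProduct.curry_injective
  apply V.linearMap_ext
  intro m v hv
  apply W.linearMap_ext
  intro n w hw
  exact h m n v w hv hw

/-! #### Tensor product -/

/-- The degree `m` projection on `V ⊗ W`, whose image is the sum of `V_n ⊗ W_l` with `n l = m`. -/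
def tensorP (V W : XRep k X) (m : X₂) : Module.End k (V.V ⊗[k] W.V) :=
  ∑ n, TensorProduct.map (V.P n) (W.P (n⁻¹ * m))

theorem tensorP_homog (V W : XRep k X) {m n : X₂} {v : V.V} {w : W.V} (hv : V.P m v = v)
    (hw : W.P n w = w) : tensorP V W (m * n) (v ⊗ₜ w) = v ⊗ₜ w := by
  classical
  rw [tensorP, LinearMap.sum_apply, Finset.sum_eq_single m]
  · simp [hv, hw]
  · intro b _ hb
    simp [V.P_eq_zero hv hb]
  · simp

theorem tensorP_of_ne (V W : XRep k X) {m n l : X₂} {v : V.V} {w : W.V} (hv : V.P m v = v)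
    (hw : W.P n w = w) (h : l ≠ m * n) : tensorP V W l (v ⊗ₜ w) = 0 := by
  classical
  rw [tensorP, LinearMap.sum_apply]
  apply Finset.sum_eq_zero
  intro b _
  by_cases hb : b = m
  · subst hb
    have : b⁻¹ * l ≠ n := fun e => h (by rw [← e]; group)
    simp [W.P_eq_zero hw this]
  · simp [V.P_eq_zero hv hb]

/-- The tensor product of representations. -/
abbrev tensor (V W : XRep k X) : XRep k X where
  V := V.V ⊗[k] W.V
  P := tensorP V W
  Q :=
    { toFun := fun g => TensorProduct.map (V.Q g) (W.Q g)
      map_one' := by simp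
      map_mul' := fun g h => by simp [TensorProduct.map_mul] }
  P_mul_self m := by
    apply tensor_ext
    intro a b v w hv hw
    by_cases h : m = a * b
    · subst h; simp [tensorP_homog V W hv hw]
    · simp [tensorP_of_ne V W hv hw h]
  P_mul_of_ne m n hmn := by
    apply tensor_ext
    intro a b v w hv hw
    by_cases h : n = a * b
    · subst h; simp [tensorP_homog V W hv hw, tensorP_of_ne V W hv hw hmn]
    · simp [tensorP_of_ne V W hv hw h]
  sum_P := by
    apply tensor_ext
    intro a b v w hv hw
    rw [LinearMap.sum_apply, Finset.sum_eq_single (a * b)]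
    · simp [tensorP_homog V W hv hw]
    · intro c _ hc
      exact tensorP_of_ne V W hv hw hc
    · simp
  P_mul_Q m g := by
    apply tensor_ext
    intro a b v w hv hw
    have hv' := V.Q_homog hv g
    have hw' := W.Q_homog hw g
    by_cases h : X.act m g = a * b
    · have h' : m = X.act a g⁻¹ * X.act b g⁻¹ := by
        rw [← X.mul_act, ← h, ← X.act_mul]; simp [X.act_one]
      have e := tensorP_homog V W hv' hw'
      rw [← h'] at e
      simp [e, h, tensorP_homog V W hv hw]
    · have h' : m ≠ X.act a g⁻¹ * X.act b g⁻¹ := by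
        rintro rfl
        apply h
        rw [X.mul_act, ← X.act_mul, ← X.act_mul]; simp [X.act_one]
      have e := tensorP_of_ne V W hv' hw' h'
      simp [e, tensorP_of_ne V W hv hw h]

open Classical in
/-- The tensor unit: the ground field in degree `1`, with the trivial action. -/
noncomputable abbrev unit : XRep k X where
  V := k
  P m := if m = 1 then 1 else 0
  Q := 1
  P_mul_self m := by split_ifs <;> simp
  P_mul_of_ne m n h := by
    by_cases hm : m = 1
    · subst hm; simp [h.symm]
    · simp [hm]
  sum_P := by simp
  P_mul_Q m g := by
    have h1 : X.act 1 g = 1 := by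
      have := X.mul_act 1 1 g
      simpa using this
    have : X.act m g = 1 ↔ m = 1 := by
      constructor
      · intro h
        have h2 := congrArg (fun x => X.act x g⁻¹) h
        have h3 : X.act 1 g⁻¹ = 1 := by
          have := X.mul_act 1 1 g⁻¹
          simpa using this
        simpa [← X.act_mul, X.act_one, h3] using h2
      · rintro rfl; exact h1
    simp [this]

theorem unit_P_one (c : k) : (unit : XRep k X).P 1 c = c := by
  have : (unit : XRep k X).P 1 = 1 := if_pos rfl
  rw [this]; rfl

theorem unit_P_of_ne {m : X₂} (h : m ≠ 1) : (unit : XRep k X).P m = 0 := if_neg h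

theorem map_P_of_homog {V W : XRep k X} (f : V.V →ₗ[k] W.V)
    (h : ∀ m v, V.P m v = v → W.P m (f v) = f v) (m : X₂) (v : V.V) :
    f (V.P m v) = W.P m (f v) := by
  suffices f ∘ₗ V.P m = W.P m ∘ₗ f from LinearMap.congr_fun this v
  apply V.linearMap_ext
  intro n v hv
  by_cases hmn : m = n
  · subst hmn; simp [hv, h m v hv]
  · simp [V.P_eq_zero hv hmn, W.P_eq_zero (h n v hv) hmn]

theorem map_P_of_homog₂ {U V W : XRep k X} (f : U.V ⊗[k] V.V →ₗ[k] W.V)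
    (h : ∀ m n u v, U.P m u = u → V.P n v = v → W.P (m * n) (f (u ⊗ₜ v)) = f (u ⊗ₜ v))
    (m : X₂) (v : U.V ⊗[k] V.V) : f (tensorP U V m v) = W.P m (f v) := by
  suffices f ∘ₗ tensorP U V m = W.P m ∘ₗ f from LinearMap.congr_fun this v
  apply tensor_ext
  intro a b u v hu hv
  have hf := h a b u v hu hv
  by_cases hmn : m = a * b
  · subst hmn
    simp [hf, tensorP_homog U V hu hv]
  · simp [W.P_eq_zero hf hmn, tensorP_of_ne U V hu hv hmn]

/-- A morphism out of a tensor product, from a linear map. -/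
def homMk₂ {U V W : XRep k X} (f : U.V ⊗[k] V.V →ₗ[k] W.V)
    (h : ∀ m n u v, U.P m u = u → V.P n v = v → W.P (m * n) (f (u ⊗ₜ v)) = f (u ⊗ₜ v))
    (hQ : ∀ g m n u v, U.P m u = u → V.P n v = v →
      f (U.Q g u ⊗ₜ V.Q g v) = W.Q g (f (u ⊗ₜ v))) :
    tensor U V ⟶ W where
  lin := f
  map_P := map_P_of_homog₂ f h
  map_Q g v := by
    suffices f ∘ₗ TensorProduct.map (U.Q g) (V.Q g) = W.Q g ∘ₗ f from LinearMap.congr_fun this v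
    apply tensor_ext
    intro a b u v hu hv
    simp [hQ g a b u v hu hv]

/-- An isomorphism from a morphism whose underlying linear map is bijective. -/
def isoMk {V W : XRep k X} (f : V ⟶ W) (g : W.V →ₗ[k] V.V) (h₁ : ∀ v, g (f.lin v) = v)
    (h₂ : ∀ v, f.lin (g v) = v) : V ≅ W :=
  mkIso f ⟨g, fun m v => by rw [← h₁ (V.P m (g v)), f.map_P, h₂],
    fun m v => by rw [← h₁ (V.Q m (g v)), f.map_Q, h₂]⟩ h₁ h₂

@[simp] theorem isoMk_hom {V W : XRep k X} (f : V ⟶ W) (g : W.V →ₗ[k] V.V) (h₁ h₂) :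
    (isoMk f g h₁ h₂).hom = f := rfl

@[simp] theorem isoMk_inv_lin {V W : XRep k X} (f : V ⟶ W) (g : W.V →ₗ[k] V.V) (h₁ h₂) :
    (isoMk f g h₁ h₂).inv.lin = g := rfl

theorem tensor_ext₃ (U V W : XRep k X) {M : Type*} [AddCommGroup M] [Module k M]
    {f g : (U.V ⊗[k] V.V) ⊗[k] W.V →ₗ[k] M}
    (h : ∀ l m n u v w, U.P l u = u → V.P m v = v → W.P n w = w →
      f ((u ⊗ₜ v) ⊗ₜ w) = g ((u ⊗ₜ v) ⊗ₜ w)) : f = g := by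
  apply TensorProduct.curry_injective
  apply tensor_ext
  intro l m u v hu hv
  apply W.linearMap_ext
  intro n w hw
  exact h l m n u v w hu hv hw

theorem tensor_ext₃' (U V W : XRep k X) {M : Type*} [AddCommGroup M] [Module k M]
    {f g : U.V ⊗[k] (V.V ⊗[k] W.V) →ₗ[k] M}
    (h : ∀ l m n u v w, U.P l u = u → V.P m v = v → W.P n w = w →
      f (u ⊗ₜ (v ⊗ₜ w)) = g (u ⊗ₜ (v ⊗ₜ w))) : f = g := by
  apply TensorProduct.curry_injective
  apply U.linearMap_ext
  intro l u hu
  apply tensor_ext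
  intro m n v w hv hw
  exact h l m n u v w hu hv hw

/-- The tensor product of morphisms. -/
def tensorMap {U V U' V' : XRep k X} (f : U ⟶ U') (g : V ⟶ V') : tensor U V ⟶ tensor U' V' :=
  homMk₂ (W := tensor U' V') (TensorProduct.map f.lin g.lin)
    (fun m n u v hu hv => tensorP_homog U' V' (by rw [← f.map_P, hu]) (by rw [← g.map_P, hv]))
    (fun l m n u v hu hv => by
      rw [TensorProduct.map_tmul, f.map_Q, g.map_Q]; rfl)

/-- The associator. -/
def assoc (U V W : XRep k X) : tensor (tensor U V) W ≅ tensor U (tensor V W) :=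
  isoMk
    { lin := (TensorProduct.assoc k U.V V.V W.V).toLinearMap
      map_P := by
        intro m x
        suffices (TensorProduct.assoc k U.V V.V W.V).toLinearMap ∘ₗ tensorP (tensor U V) W m =
          tensorP U (tensor V W) m ∘ₗ (TensorProduct.assoc k U.V V.V W.V).toLinearMap from
          LinearMap.congr_fun this x
        apply tensor_ext₃
        intro a b c u v w hu hv hw
        have h1 := tensorP_homog U V hu hv
        have h2 := tensorP_homog V W hv hw
        by_cases h : m = a * b * c
        · have e1 := tensorP_homog (tensor U V) W h1 hw
          have e2 := tensorP_homog U (tensor V W) hu h2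
          rw [← h] at e1
          rw [← mul_assoc, ← h] at e2
          rw [LinearMap.comp_apply, LinearMap.comp_apply]
          exact (congrArg (TensorProduct.assoc k U.V V.V W.V) e1).trans e2.symm
        · have e1 := tensorP_of_ne (tensor U V) W h1 hw h
          have e2 := tensorP_of_ne U (tensor V W) hu h2 (by rwa [← mul_assoc])
          rw [LinearMap.comp_apply, LinearMap.comp_apply]
          exact (congrArg (TensorProduct.assoc k U.V V.V W.V) e1).trans
            ((map_zero _).trans e2.symm)
      map_Q := by
        intro g x
        suffices (TensorProduct.assoc k U.V V.V W.V).toLinearMap ∘ₗ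
            TensorProduct.map (TensorProduct.map (U.Q g) (V.Q g)) (W.Q g) =
          TensorProduct.map (U.Q g) (TensorProduct.map (V.Q g) (W.Q g)) ∘ₗ
            (TensorProduct.assoc k U.V V.V W.V).toLinearMap from
          LinearMap.congr_fun this x
        ext u v w
        simp }
    (TensorProduct.assoc k U.V V.V W.V).symm.toLinearMap
    (TensorProduct.assoc k U.V V.V W.V).symm_apply_apply
    (TensorProduct.assoc k U.V V.V W.V).apply_symm_apply

theorem unit_homog {m : X₂} {c : k} (hc : (unit : XRep k X).P m c = c) : m = 1 ∨ c = 0 := by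
  by_cases h : m = 1
  · exact Or.inl h
  · rw [unit_P_of_ne h] at hc; exact Or.inr hc.symm

/-- The left unitor. -/
noncomputable def leftUnit (V : XRep k X) : tensor unit V ≅ V :=
  isoMk (homMk₂ (U := unit) (TensorProduct.lid k V.V).toLinearMap
      (fun m n (c : k) v hc hv => by
        change V.P (m * n) (c • v) = c • v
        rcases unit_homog hc with rfl | rfl <;> simp [hv])
      (fun g m n (c : k) v _ _ => by
        change c • V.Q g v = V.Q g (c • v)
        simp))
    (TensorProduct.lid k V.V).symm.toLinearMap
    (TensorProduct.lid k V.V).symm_apply_apply (TensorProduct.lid k V.V).apply_symm_apply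

/-- The right unitor. -/
noncomputable def rightUnit (V : XRep k X) : tensor V unit ≅ V :=
  isoMk (homMk₂ (V := unit) (TensorProduct.rid k V.V).toLinearMap
      (fun m n v (c : k) hv hc => by
        change V.P (m * n) (c • v) = c • v
        rcases unit_homog hc with rfl | rfl <;> simp [hv])
      (fun g m n v (c : k) _ _ => by
        change c • V.Q g v = V.Q g (c • v)
        simp))
    (TensorProduct.rid k V.V).symm.toLinearMap
    (TensorProduct.rid k V.V).symm_apply_apply (TensorProduct.rid k V.V).apply_symm_apply

noncomputable instance : MonoidalCategoryStruct (XRep k X) where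
  tensorObj := tensor
  tensorHom f g := tensorMap f g
  whiskerLeft V _ _ f := tensorMap (𝟙 V) f
  whiskerRight f V := tensorMap f (𝟙 V)
  tensorUnit := unit
  associator := assoc
  leftUnitor := leftUnit
  rightUnitor := rightUnit

noncomputable instance : MonoidalCategory (XRep k X) where
  tensorHom_def f g := by
    apply hom_ext; apply TensorProduct.ext'; intro u v; rfl
  id_tensorHom_id V W := by
    apply hom_ext; apply TensorProduct.ext'; intro u v; rfl
  tensorHom_comp_tensorHom f₁ f₂ g₁ g₂ := by
    apply hom_ext; apply TensorProduct.ext'; intro u v; rfl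
  whiskerLeft_id V W := by
    apply hom_ext; apply TensorProduct.ext'; intro u v; rfl
  id_whiskerRight V W := by
    apply hom_ext; apply TensorProduct.ext'; intro u v; rfl
  associator_naturality f₁ f₂ f₃ := by
    apply hom_ext; apply TensorProduct.ext_threefold; intro u v w; rfl
  leftUnitor_naturality f := by
    apply hom_ext; apply TensorProduct.ext'; intro c v
    exact (f.lin.map_smul c v).symm
  rightUnitor_naturality f := by
    apply hom_ext; apply TensorProduct.ext'; intro v c
    exact (f.lin.map_smul c v).symm
  pentagon U V W Z := by
    apply hom_ext; apply TensorProduct.ext_fourfold; intro u v w z; rfl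
  triangle V W := by
    apply hom_ext; apply TensorProduct.ext_threefold; intro v c w
    exact (TensorProduct.smul_tmul (R := k) (c : k) v w).symm

/-! #### Braiding -/

/-- The linear map `v ⊗ w ↦ ∑ m, Q(∂ m) w ⊗ P(m) v`. -/
def braidLin (V W : XRep k X) : V.V ⊗[k] W.V →ₗ[k] W.V ⊗[k] V.V :=
  ∑ m, TensorProduct.map (W.Q (X.bdry m)) (V.P m) ∘ₗ (TensorProduct.comm k V.V W.V).toLinearMap

theorem braidLin_homog (V W : XRep k X) {m : X₂} {v : V.V} (hv : V.P m v = v) (w : W.V) :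
    braidLin V W (v ⊗ₜ w) = W.Q (X.bdry m) w ⊗ₜ v := by
  classical
  rw [braidLin, LinearMap.sum_apply, Finset.sum_eq_single m]
  · simp [hv]
  · intro b _ hb
    simp [V.P_eq_zero hv hb]
  · simp

/-- The inverse of the braiding, `w ⊗ v ↦ ∑ m, P(m) v ⊗ Q(∂ m)⁻¹ w`. -/
def braidInvLin (V W : XRep k X) : W.V ⊗[k] V.V →ₗ[k] V.V ⊗[k] W.V :=
  ∑ m, TensorProduct.map (V.P m) (W.Q (X.bdry m)⁻¹) ∘ₗ
    (TensorProduct.comm k W.V V.V).toLinearMap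

theorem braidInvLin_homog (V W : XRep k X) {m : X₂} {v : V.V} (hv : V.P m v = v) (w : W.V) :
    braidInvLin V W (w ⊗ₜ v) = v ⊗ₜ W.Q (X.bdry m)⁻¹ w := by
  classical
  rw [braidInvLin, LinearMap.sum_apply, Finset.sum_eq_single m]
  · simp [hv]
  · intro b _ hb
    simp [V.P_eq_zero hv hb]
  · simp

theorem Q_inv_Q (V : XRep k X) (g : X₁) (v : V.V) : V.Q g⁻¹ (V.Q g v) = v := by
  rw [Q_mul]; simp

theorem Q_Q_inv (V : XRep k X) (g : X₁) (v : V.V) : V.Q g (V.Q g⁻¹ v) = v := by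
  rw [Q_mul]; simp

/-- The braiding. -/
def braid (V W : XRep k X) : tensor V W ≅ tensor W V :=
  isoMk (homMk₂ (W := tensor W V) (braidLin V W)
    (fun m n v w hv hw => by
      rw [braidLin_homog V W hv]
      have := tensorP_homog W V (W.Q_bdry_homog hw m) hv
      rwa [inv_mul_cancel_right] at this)
    (fun g m n v w hv hw => by
      rw [braidLin_homog V W hv, braidLin_homog V W (V.Q_homog hv g), X.bdry_act]
      change _ = W.Q g (W.Q (X.bdry m) w) ⊗ₜ V.Q g v
      rw [Q_mul, Q_mul]
      simp))
    (braidInvLin V W)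
    (fun x => by
      suffices braidInvLin V W ∘ₗ braidLin V W = LinearMap.id from LinearMap.congr_fun this x
      apply tensor_ext
      intro m n v w hv hw
      rw [LinearMap.comp_apply, braidLin_homog V W hv, braidInvLin_homog V W hv, Q_inv_Q]
      rfl)
    (fun x => by
      suffices braidLin V W ∘ₗ braidInvLin V W = LinearMap.id from LinearMap.congr_fun this x
      apply tensor_ext
      intro m n w v hw hv
      rw [LinearMap.comp_apply, braidInvLin_homog V W hv, braidLin_homog V W hv, Q_Q_inv]
      rfl)

noncomputable instance : BraidedCategory (XRep k X) where
  braiding := braid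
  braiding_naturality_right V W Z f := by
    apply hom_ext; apply tensor_ext V W
    intro m n v w hv hw
    change braidLin V Z (v ⊗ₜ f.lin w) = (tensorMap f (𝟙 V)).lin (braidLin V W (v ⊗ₜ w))
    rw [braidLin_homog V W hv, braidLin_homog V Z hv, ← f.map_Q]
    rfl
  braiding_naturality_left {V W} f Z := by
    apply hom_ext; apply tensor_ext V Z
    intro m n v z hv hz
    change braidLin W Z (f.lin v ⊗ₜ z) = (tensorMap (𝟙 Z) f).lin (braidLin V Z (v ⊗ₜ z))
    rw [braidLin_homog V Z hv, braidLin_homog W Z (m := m) (by rw [← f.map_P, hv])]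
    rfl
  hexagon_forward U V W := by
    apply hom_ext; apply tensor_ext₃ U V W
    intro l m n u v w hu hv hw
    change (assoc V W U).hom.lin (braidLin U (tensor V W) (u ⊗ₜ (v ⊗ₜ w))) =
      (tensorMap (𝟙 V) (braid U W).hom).lin ((assoc V U W).hom.lin
        ((braidLin U V (u ⊗ₜ v)) ⊗ₜ w))
    rw [braidLin_homog U V hu, braidLin_homog U (tensor V W) hu]
    change _ = V.Q (X.bdry l) v ⊗ₜ braidLin U W (u ⊗ₜ w)
    rw [braidLin_homog U W hu]
    rfl
  hexagon_reverse U V W := by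
    apply hom_ext; apply tensor_ext₃' U V W
    intro l m n u v w hu hv hw
    change (assoc W U V).inv.lin (braidLin (tensor U V) W ((u ⊗ₜ v) ⊗ₜ w)) =
      (tensorMap (braid U W).hom (𝟙 V)).lin ((assoc U W V).inv.lin
        (u ⊗ₜ (braidLin V W (v ⊗ₜ w))))
    rw [braidLin_homog V W hv, braidLin_homog (tensor U V) W (tensorP_homog U V hu hv)]
    change _ = braidLin U W (u ⊗ₜ (W.Q (X.bdry m) w)) ⊗ₜ v
    rw [braidLin_homog U W hu, Q_mul, ← map_mul]
    rfl

/-! #### Duals -/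

/-- The dual representation: `(V*)_m = (V_{m⁻¹})*` and `Q*(g) = Q(g⁻¹)*`. -/
abbrev dual (V : XRep k X) : XRep k X where
  V := Module.Dual k V.V
  P m := (V.P m⁻¹).dualMap
  Q :=
    { toFun := fun g => (V.Q g⁻¹).dualMap
      map_one' := by ext; simp
      map_mul' := fun g h => by ext; simp }
  P_mul_self m := by ext φ v; simp
  P_mul_of_ne m n h := by
    ext φ v
    have : n⁻¹ ≠ m⁻¹ := fun e => h (inv_injective e).symm
    simp [V.P_P_of_ne this]
  sum_P := by
    ext φ v
    rw [LinearMap.sum_apply, LinearMap.sum_apply]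
    have : ∑ m, φ (V.P m⁻¹ v) = ∑ m, φ (V.P m v) :=
      Fintype.sum_equiv (Equiv.inv X₂) _ _ fun _ => rfl
    simp only [LinearMap.dualMap_apply, this, ← map_sum, V.sum_P_apply]
    rfl
  P_mul_Q m g := by
    ext φ v
    have h1 : X.act 1 g = 1 := by simpa using X.mul_act 1 1 g
    have h2 : X.act m⁻¹ g = (X.act m g)⁻¹ := by
      rw [eq_inv_iff_mul_eq_one, ← X.mul_act, inv_mul_cancel, h1]
    have : V.Q g⁻¹ (V.P m⁻¹ v) = V.P (X.act m g)⁻¹ (V.Q g⁻¹ v) := by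
      rw [P_Q, ← h2, ← X.act_mul]; simp [X.act_one]
    simp [this]

/-- The evaluation `V* ⊗ V ⟶ 1`. -/
noncomputable def ev (V : XRep k X) : tensor (dual V) V ⟶ unit :=
  homMk₂ (U := dual V) (W := unit) (contractLeft k V.V)
    (fun m n (φ : Module.Dual k V.V) v hφ hv => by
      change (unit : XRep k X).P (m * n) (φ v) = φ v
      by_cases h : m * n = 1
      · rw [h, unit_P_one]
      · have h' : m⁻¹ ≠ n := fun e => h (by rw [← e]; simp)
        have h0 : φ v = 0 := by
          have := LinearMap.congr_fun hφ v
          rw [← this, LinearMap.dualMap_apply, V.P_eq_zero hv h', map_zero]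
        rw [h0, map_zero])
    (fun g m n (φ : Module.Dual k V.V) v _ _ => by
      change φ (V.Q g⁻¹ (V.Q g v)) = φ v
      rw [Q_inv_Q])

/-- The canonical element of `V ⊗ V*`. -/
noncomputable def coevElt (V : XRep k X) : V.V ⊗[k] Module.Dual k V.V := coevaluation k V.V 1

theorem map_coevElt (V : XRep k X) (f g : Module.End k V.V) :
    TensorProduct.map f g.dualMap V.coevElt = TensorProduct.map (f * g) LinearMap.id V.coevElt := by
  apply (TensorProduct.comm k V.V (Module.Dual k V.V)).injective
  apply (dualTensorHomEquiv k V.V V.V).injective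
  change dualTensorHom k V.V V.V _ = dualTensorHom k V.V V.V _
  ext v
  let b := Module.Basis.ofVectorSpace k V.V
  have hb : ∀ v, ∑ i, b.coord i v • b i = v := b.sum_repr
  have h1 : ∑ i, (b.coord i) (g v) • f (b i) = f (g v) := by
    simp only [← map_smul, ← map_sum, hb]
  have h2 : ∑ i, (b.coord i) v • f (g (b i)) = f (g v) := by
    simp only [← map_smul, ← map_sum, hb]
  simp only [coevElt, coevaluation_apply_one, map_sum, TensorProduct.map_tmul,
    TensorProduct.comm_tmul, LinearMap.sum_apply, dualTensorHom_apply,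
    LinearMap.dualMap_apply, Module.End.mul_apply, LinearMap.id_apply]
  exact h1.trans h2.symm

theorem tensorP_coevElt (V : XRep k X) (m : X₂) :
    tensorP V (dual V) m V.coevElt = (unit : XRep k X).P m (1 : k) • V.coevElt := by
  have h : ∀ n, TensorProduct.map (V.P n) ((dual V).P (n⁻¹ * m)) V.coevElt =
      TensorProduct.map (V.P n * V.P (n⁻¹ * m)⁻¹) LinearMap.id V.coevElt := fun n =>
    map_coevElt V _ _
  rw [tensorP, LinearMap.sum_apply, Finset.sum_congr rfl fun n _ => h n]
  by_cases hm : m = 1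
  · subst hm
    rw [unit_P_one, one_smul]
    simp only [mul_one, inv_inv, V.P_mul_self]
    rw [← LinearMap.sum_apply]
    have : ∑ n, TensorProduct.map (V.P n) (LinearMap.id : Module.Dual k V.V →ₗ[k] _) =
        TensorProduct.map (∑ n, V.P n) LinearMap.id := by
      apply TensorProduct.ext'
      intro v φ
      simp [LinearMap.sum_apply, TensorProduct.sum_tmul]
    rw [this, V.sum_P]
    exact LinearMap.congr_fun TensorProduct.map_id V.coevElt
  · rw [unit_P_of_ne hm]
    have h0 : ∀ n, V.P n * V.P (n⁻¹ * m)⁻¹ = 0 := fun n =>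
      V.P_mul_of_ne _ _ fun e => hm (by
        have e' : n⁻¹ * m = n⁻¹ := by rw [← inv_inv (n⁻¹ * m), ← e]
        simpa using e')
    simp only [h0, TensorProduct.map_zero_left, LinearMap.zero_apply, Finset.sum_const_zero,
      zero_smul]

/-- The coevaluation `1 ⟶ V ⊗ V*`. -/
noncomputable def coev (V : XRep k X) : unit ⟶ tensor V (dual V) where
  lin := coevaluation k V.V
  map_P m (c : k) := by
    have hc : ∀ c : k, coevaluation k V.V c = c • V.coevElt := fun c => by
      rw [coevElt, ← map_smul, smul_eq_mul, mul_one]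
    have h1 : (unit : XRep k X).P m c = c * (unit : XRep k X).P m (1 : k) := by
      have := ((unit : XRep k X).P m).map_smul c (1 : k)
      simpa using this
    change coevaluation k V.V ((unit : XRep k X).P m c) = tensorP V (dual V) m _
    rw [hc, hc, map_smul, tensorP_coevElt, h1, mul_smul]
  map_Q g (c : k) := by
    have hc : coevaluation k V.V c = c • V.coevElt := by
      rw [coevElt, ← map_smul, smul_eq_mul, mul_one]
    change coevaluation k V.V c = TensorProduct.map (V.Q g) (V.Q g⁻¹).dualMap _
    rw [hc, map_smul, map_coevElt, ← map_mul, mul_inv_cancel, map_one]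
    exact congrArg (c • ·) (LinearMap.congr_fun TensorProduct.map_id V.coevElt).symm

noncomputable instance (V : XRep k X) : ExactPairing V (dual V) where
  coevaluation' := coev V
  evaluation' := ev V
  coevaluation_evaluation' := hom_ext (contractLeft_assoc_coevaluation k V.V)
  evaluation_coevaluation' := hom_ext (contractLeft_assoc_coevaluation' k V.V)

noncomputable instance : RightRigidCategory (XRep k X) where
  rightDual V := ⟨dual V⟩

/-! #### Twist -/

/-- The linear map `∑ m, P(m) Q(∂ m)`. -/
def twistLin (V : XRep k X) : Module.End k V.V := ∑ m, V.P m * V.Q (X.bdry m)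

theorem twistLin_homog (V : XRep k X) {m : X₂} {v : V.V} (hv : V.P m v = v) :
    twistLin V v = V.Q (X.bdry m) v := by
  classical
  have h : V.P m (V.Q (X.bdry m) v) = V.Q (X.bdry m) v := by
    simpa using V.Q_bdry_homog hv m
  rw [twistLin, LinearMap.sum_apply, Finset.sum_eq_single m]
  · exact h
  · intro b _ hb
    refine V.P_eq_zero (V.Q_bdry_homog hv b) fun e => hb ?_
    have := congrArg (fun x => b⁻¹ * x * b) e
    simpa [mul_assoc] using this
  · simp

/-- The inverse of the twist. -/
def twistInvLin (V : XRep k X) : Module.End k V.V := ∑ m, V.P m * V.Q (X.bdry m)⁻¹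

theorem twistInvLin_homog (V : XRep k X) {m : X₂} {v : V.V} (hv : V.P m v = v) :
    twistInvLin V v = V.Q (X.bdry m)⁻¹ v := by
  classical
  have h : V.P m (V.Q (X.bdry m)⁻¹ v) = V.Q (X.bdry m)⁻¹ v := by
    simpa using V.Q_bdry_homog hv m⁻¹
  rw [twistInvLin, LinearMap.sum_apply, Finset.sum_eq_single m]
  · exact h
  · intro b _ hb
    have hb' : V.P (b⁻¹ * m * b) (V.Q (X.bdry b)⁻¹ v) = V.Q (X.bdry b)⁻¹ v := by
      simpa using V.Q_bdry_homog hv b⁻¹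
    refine V.P_eq_zero hb' fun e => hb ?_
    have := congrArg (fun x => b * x * b⁻¹) e
    simpa [mul_assoc] using this
  · simp

theorem twistLin_mem (V : XRep k X) {m : X₂} {v : V.V} (hv : V.P m v = v) :
    V.P m (twistLin V v) = twistLin V v := by
  rw [twistLin_homog V hv]
  simpa using V.Q_bdry_homog hv m

/-- The twist `θ_V = ∑ m, P(m) Q(∂ m)`. -/
def twist (V : XRep k X) : V ≅ V :=
  isoMk
    { lin := twistLin V
      map_P := map_P_of_homog _ fun _ _ hv => twistLin_mem V hv
      map_Q := fun g v => by
        suffices twistLin V ∘ₗ V.Q g = V.Q g ∘ₗ twistLin V from LinearMap.congr_fun this v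
        apply V.linearMap_ext
        intro m v hv
        rw [LinearMap.comp_apply, LinearMap.comp_apply, twistLin_homog V hv,
          twistLin_homog V (V.Q_homog hv g), X.bdry_act, Q_mul, Q_mul]
        simp }
    (twistInvLin V)
    (fun v => by
      suffices twistInvLin V ∘ₗ twistLin V = LinearMap.id from LinearMap.congr_fun this v
      apply V.linearMap_ext
      intro m v hv
      rw [LinearMap.comp_apply, twistInvLin_homog V (twistLin_mem V hv), twistLin_homog V hv,
        Q_inv_Q]
      rfl)
    (fun v => by
      suffices twistLin V ∘ₗ twistInvLin V = LinearMap.id from LinearMap.congr_fun this v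
      apply V.linearMap_ext
      intro m v hv
      have h : V.P m (V.Q (X.bdry m)⁻¹ v) = V.Q (X.bdry m)⁻¹ v := by
        simpa using V.Q_bdry_homog hv m⁻¹
      rw [LinearMap.comp_apply, twistInvLin_homog V hv, twistLin_homog V h, Q_Q_inv]
      rfl)

theorem rightAdjointMate_lin {V W : XRep k X} (f : V ⟶ W) (φ : Module.Dual k W.V) (v : V.V) :
    DFunLike.coe (F := Module.Dual k V.V) ((fᘁ).lin φ) v = φ (f.lin v) := by
  have h := congrArg Hom.lin (rightAdjointMate_comp_evaluation f)
  exact LinearMap.congr_fun h (φ ⊗ₜ[k] v)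

noncomputable instance : RibbonCategory (XRep k X) where
  twist := twist
  twist_naturality {V W} f := by
    apply hom_ext; apply V.linearMap_ext
    intro m v hv
    change twistLin W (f.lin v) = f.lin (twistLin V v)
    rw [twistLin_homog V hv, f.map_Q, twistLin_homog W (m := m) (by rw [← f.map_P, hv])]
  twist_tensor V W := by
    apply hom_ext; apply tensor_ext V W
    intro m n v w hv hw
    change twistLin (tensor V W) (v ⊗ₜ w) = braidLin W V (braidLin V W (twistLin V v ⊗ₜ twistLin W w))
    rw [twistLin_homog (tensor V W) (tensorP_homog V W hv hw),
      braidLin_homog V W (twistLin_mem V hv), braidLin_homog W V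
        (W.Q_bdry_homog (twistLin_mem W hw) m), twistLin_homog V hv, twistLin_homog W hw,
      Q_mul, Q_mul, ← map_mul, ← map_mul]
    simp only [inv_mul_cancel_right]
    rfl
  twist_dual V := by
    apply hom_ext; apply (dual V).linearMap_ext
    intro m (φ : Module.Dual k V.V) hφ
    apply LinearMap.ext
    intro (v : V.V)
    have e := rightAdjointMate_lin (twist V).hom φ v
    refine Eq.trans ?_ e.symm
    change twistLin (dual V) φ v = φ (twistLin V v)
    have e2 : twistLin (dual V) φ = φ ∘ₗ V.Q (X.bdry m)⁻¹ := twistLin_homog (dual V) hφ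
    rw [e2]
    change φ ∘ₗ V.P m⁻¹ = φ at hφ
    suffices φ ∘ₗ V.Q (X.bdry m)⁻¹ = φ ∘ₗ twistLin V from LinearMap.congr_fun this v
    apply V.linearMap_ext
    intro n v hv
    rw [LinearMap.comp_apply, LinearMap.comp_apply]
    by_cases h : n = m⁻¹
    · subst h
      rw [twistLin_homog V hv, map_inv X.bdry]
    · have h1 : φ (twistLin V v) = 0 := by
        rw [← hφ, LinearMap.comp_apply, V.P_eq_zero (twistLin_mem V hv) (Ne.symm h), map_zero]
      have h2 : V.P (m⁻¹ * n * m) (V.Q (X.bdry m)⁻¹ v) = V.Q (X.bdry m)⁻¹ v := by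
        simpa using V.Q_bdry_homog hv m⁻¹
      have h3 : m⁻¹ ≠ m⁻¹ * n * m := by
        intro e3
        apply h
        have := congrArg (fun x => m * x * m⁻¹) e3
        simpa [mul_assoc] using this.symm
      rw [h1, ← hφ, LinearMap.comp_apply, V.P_eq_zero h2 h3, map_zero]

/-! #### Traces, dimensions, S-matrix -/

open RibbonCategory

/-- The scalar by which an endomorphism of the tensor unit acts, under `End(1) = k`. -/
noncomputable def scalar (f : 𝟙_ (XRep k X) ⟶ 𝟙_ (XRep k X)) : k := f.lin (1 : k)

theorem scalar_trace {V : XRep k X} (f : V ⟶ V) :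
    scalar (trace f) = LinearMap.trace k V.V f.lin := by
  have key : (contractLeft k V.V ∘ₗ braidLin V (dual V)) ∘ₗ
      TensorProduct.map (twistLin V) LinearMap.id =
      contractLeft k V.V ∘ₗ (TensorProduct.comm k V.V (Module.Dual k V.V)).toLinearMap := by
    apply tensor_ext V (dual V)
    intro m n v (φ : Module.Dual k V.V) hv hφ
    rw [LinearMap.comp_apply, LinearMap.comp_apply, TensorProduct.map_tmul,
      braidLin_homog V (dual V) (twistLin_mem V hv), twistLin_homog V hv]
    change φ (V.Q (X.bdry m)⁻¹ (V.Q (X.bdry m) v)) = φ v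
    rw [Q_inv_Q]
  have h : scalar (trace f) = contractLeft k V.V (braidLin V (dual V)
      (TensorProduct.map (twistLin V ∘ₗ f.lin) LinearMap.id V.coevElt)) := rfl
  have h2 : TensorProduct.map (twistLin V ∘ₗ f.lin) LinearMap.id V.coevElt =
      TensorProduct.map (twistLin V) LinearMap.id (TensorProduct.map f.lin LinearMap.id V.coevElt) := by
    rw [← LinearMap.comp_apply, ← TensorProduct.map_comp, LinearMap.id_comp]
  have h3 := LinearMap.congr_fun key (TensorProduct.map f.lin LinearMap.id V.coevElt)
  rw [h, h2]
  refine h3.trans ?_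
  classical
  rw [coevElt, coevaluation_apply_one,
    LinearMap.trace_eq_matrix_trace k (Module.Basis.ofVectorSpace k V.V)]
  simp [Matrix.trace, LinearMap.toMatrix_apply]

/-- The categorical dimension. -/
noncomputable def dim (V : XRep k X) : k := scalar (trace (𝟙 V))

/-- The entry `s_{VW} = tr(R_{WV} ∘ R_{VW})`. -/
noncomputable def sEntry (V W : XRep k X) : k := scalar (trace ((β_ V W).hom ≫ (β_ W V).hom))

theorem scalar_trace_conj {V W : XRep k X} (e : V ≅ W) (f : V ⟶ V) :
    scalar (trace (e.inv ≫ f ≫ e.hom)) = scalar (trace f) := by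
  rw [scalar_trace, scalar_trace, comp_lin, LinearMap.trace_comp_comm', ← comp_lin,
    Category.assoc, e.hom_inv_id, Category.comp_id]

theorem dim_congr {V W : XRep k X} (e : V ≅ W) : dim V = dim W := by
  rw [dim, ← scalar_trace_conj e]; simp [dim]

theorem sEntry_congr {V V' W W' : XRep k X} (e : V ≅ V') (e' : W ≅ W') :
    sEntry V W = sEntry V' W' := by
  rw [sEntry, sEntry, ← scalar_trace_conj (e ⊗ᵢ e')]
  congr 2
  simp

variable (k X)

/-- The isomorphism classes of objects of `M(X)`. -/
abbrev IsoClass : Type _ := Quotient (isIsomorphicSetoid (XRep k X))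

variable {k X}

/-- The dimension `d_p` of an isomorphism class. -/
noncomputable def IsoClass.dim : IsoClass k X → k :=
  Quotient.lift XRep.dim fun _ _ ⟨e⟩ => dim_congr e

/-- The number `s_{pq}` for isomorphism classes `p` and `q`. -/
noncomputable def IsoClass.s : IsoClass k X → IsoClass k X → k :=
  Quotient.lift₂ sEntry fun _ _ _ _ ⟨e⟩ ⟨e'⟩ => sEntry_congr e e'

variable (k X)

/-- The isomorphism class of the tensor unit. -/
noncomputable def unitClass : IsoClass k X := Quotient.mk _ (𝟙_ (XRep k X))

/-- The set `Λ` of isomorphism classes of simple objects. -/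
def simpleClasses : Set (IsoClass k X) :=
  {p | ∃ V : XRep k X, Simple V ∧ Quotient.mk _ V = p}

/-- The set `T` of isomorphism classes of simple transparent objects. -/
def transparentClasses : Set (IsoClass k X) :=
  {p | ∃ V : XRep k X, Simple V ∧ IsTransparent V ∧ Quotient.mk _ V = p}

/-- The classes in `Λ` whose row of the S-matrix is collinear with the row of the tensor unit. -/
def collinearClasses : Set (IsoClass k X) :=
  {p | p ∈ simpleClasses k X ∧
    ∃ α : k, ∀ q ∈ simpleClasses k X, p.s q = α * (unitClass k X).s q}

/-- The set `M` of all `p` in `Λ` such that `s_{pq} = d_p d_q` for all `q` in `Λ`. -/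
def M : Set (IsoClass k X) :=
  {p | p ∈ simpleClasses k X ∧ ∀ q ∈ simpleClasses k X, p.s q = p.dim * q.dim}

end XRep

/-!
The argument runs through the characters `χ_V(m, g) = tr(P(m) Q(g))` and the regular object `R` of
functions on `X₂ × X₁`, whose character is `|X₁|` at `g = 1` and vanishes elsewhere.

On every object `V` the operator `τ = |X₂|⁻¹ ∑ P(m) Q(∂ n)`, over `m ∈ ker ∂` and `n ∈ X₂`, is an
idempotent endomorphism, and `τ = 1` says that the degrees of `V` lie in `ker ∂` and that the image
of `∂` acts trivially. This visibly makes `V` transparent with trivial twist. Conversely the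
S-matrix entry `s_{VW}` is bilinear in the characters, and for `W = R` it equals `tr(τ) · dim R`
(`XRep.sEntry_regular`). Hence `s_{VR} = dim V · dim R` forces `tr τ = dim V`, so that the idempotent
`τ` is the identity, the characteristic being zero (`XRep.transparentProj_eq_one_of_sEntry`).
A transparent `V` satisfies this hypothesis, and so does a `V` in `M`, because the character of `R`
is the sum of the characters of its composition factors. This gives the equality of the sets of
classes and the triviality of the twist.

For the sum of squares, the usual averaging projection and Schur's lemma give the orthogonality of
simple characters (`XRep.character_orthonormal`). So every simple class `p` occurs in `R` with
multiplicity `d_p` (`XRep.exists_regular_decomposition`); in particular there are finitely many. By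
Schur's lemma the trace of `τ` on `p` is `d_p` if `p` is transparent and `0` otherwise. Summing over
the composition factors of `R` identifies `∑ d_p²` over the transparent classes with the trace of
`τ` on `R`, which the character of `R` evaluates to `|ker ∂|² |X₁| / |X₂| = |ker ∂| |coker ∂|`.
-/

/-! ### The action of a crossed module -/

namespace CrossedModule

variable {X₁ : Type v₁} {X₂ : Type v₂} [Group X₁] [Group X₂] (X : CrossedModule X₁ X₂)

theorem act_act_inv (m : X₂) (g : X₁) : X.act (X.act m g) g⁻¹ = m := by
  rw [← X.act_mul, mul_inv_cancel, X.act_one]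

theorem act_inv_act (m : X₂) (g : X₁) : X.act (X.act m g⁻¹) g = m := by
  rw [← X.act_mul, inv_mul_cancel, X.act_one]

/-- The permutation `m ↦ m ^ g` of `X₂`. -/
def actEquiv (g : X₁) : X₂ ≃ X₂ where
  toFun m := X.act m g
  invFun m := X.act m g⁻¹
  left_inv m := X.act_act_inv m g
  right_inv m := X.act_inv_act m g

@[simp] theorem actEquiv_apply (g : X₁) (m : X₂) : X.actEquiv g m = X.act m g := rfl

theorem bdry_act_eq_one_iff (m : X₂) (g : X₁) : X.bdry (X.act m g) = 1 ↔ X.bdry m = 1 := by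
  rw [X.bdry_act]
  constructor
  · intro h
    have := congrArg (fun x => g * x * g⁻¹) h
    simpa [mul_assoc] using this
  · intro h
    simp [h]

/-- The kernel of the boundary map is central. -/
theorem conj_of_bdry_eq_one {m : X₂} (hm : X.bdry m = 1) (n : X₂) : n⁻¹ * m * n = m := by
  have h := X.act_bdry n m
  rw [hm, X.act_one] at h
  have h' : m * n = n * m := by
    have := congrArg (fun x => m * x) h
    simpa [mul_assoc] using this
  rw [mul_assoc, h', inv_mul_cancel_left]

end CrossedModule

namespace XRep

open RibbonCategory

variable {k : Type u} [Field k] {X₁ : Type v₁} {X₂ : Type v₂} [Group X₁] [Group X₂]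
  [Fintype X₂] {X : CrossedModule X₁ X₂}

/-! ### Characters -/

/-- The character of an object: `χ_V(m, g) = tr(P(m) Q(g))`. -/
noncomputable def character (V : XRep k X) (m : X₂) (g : X₁) : k :=
  LinearMap.trace k V.V (V.P m * V.Q g)

theorem character_congr {V W : XRep k X} (e : V ≅ W) : character V = character W := by
  funext m g
  have h1 : e.inv.lin ∘ₗ e.hom.lin = LinearMap.id := congrArg Hom.lin e.hom_inv_id
  have h2 : e.hom.lin ∘ₗ e.inv.lin = LinearMap.id := congrArg Hom.lin e.inv_hom_id
  have h3 : W.P m * W.Q g = (e.hom.lin ∘ₗ (V.P m * V.Q g)) ∘ₗ e.inv.lin := by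
    ext w
    have hw : e.hom.lin (e.inv.lin w) = w := LinearMap.congr_fun h2 w
    simp [e.hom.map_P, e.hom.map_Q, hw]
  rw [character, character, h3, LinearMap.trace_comp_comm', ← LinearMap.comp_assoc, h1,
    LinearMap.id_comp]

theorem dim_eq_finrank (V : XRep k X) : dim V = (Module.finrank k V.V : k) := by
  rw [dim, scalar_trace, id_lin, LinearMap.trace_id]

theorem dim_eq_sum_character (V : XRep k X) : dim V = ∑ m, character V m 1 := by
  simp only [character, map_one, mul_one]
  rw [← map_sum, V.sum_P, LinearMap.trace_one, dim_eq_finrank]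

theorem braid_braid_lin (V W : XRep k X) :
    Hom.lin ((β_ V W).hom ≫ (β_ W V).hom) = ∑ m, ∑ n, TensorProduct.map
      (V.Q (X.bdry (m * n * m⁻¹)) * V.P m) (W.Q (X.bdry m) * W.P n) := by
  classical
  apply tensor_ext V W
  intro m n v w hv hw
  change braidLin W V (braidLin V W (v ⊗ₜ w)) = _
  rw [braidLin_homog V W hv, braidLin_homog W V (W.Q_bdry_homog hw m),
    LinearMap.sum_apply, Finset.sum_eq_single m, LinearMap.sum_apply, Finset.sum_eq_single n]
  · simp [hv, hw]
  · intro b _ hb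
    simp [W.P_eq_zero hw hb]
  · simp
  · intro b _ hb
    simp [V.P_eq_zero hv hb]
  · simp

/-- The S-matrix entries only depend on the characters. -/
theorem sEntry_eq_sum_character (V W : XRep k X) :
    sEntry V W = ∑ m, ∑ n, character V m (X.bdry (m * n * m⁻¹)) * character W n (X.bdry m) := by
  rw [sEntry, scalar_trace, braid_braid_lin]
  simp only [map_sum]
  refine Finset.sum_congr rfl fun m _ => Finset.sum_congr rfl fun n _ => ?_
  refine (LinearMap.trace_tensorProduct' _ _).trans ?_
  rw [LinearMap.trace_mul_comm, LinearMap.trace_mul_comm k (W.Q _)]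
  rfl

theorem sEntry_of_isTransparent {V : XRep k X} (hV : IsTransparent V) (W : XRep k X) :
    sEntry V W = dim V * dim W := by
  rw [sEntry, hV W, Iso.hom_inv_id, scalar_trace, id_lin, LinearMap.trace_id]
  change ((Module.finrank k (V.V ⊗[k] W.V) : ℕ) : k) = _
  rw [Module.finrank_tensorProduct, Nat.cast_mul, dim_eq_finrank, dim_eq_finrank]

theorem dim_unit : dim (𝟙_ (XRep k X)) = 1 := by
  rw [dim_eq_finrank]
  change ((Module.finrank k k : ℕ) : k) = 1
  rw [Module.finrank_self, Nat.cast_one]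

theorem sEntry_unit (W : XRep k X) : sEntry (𝟙_ (XRep k X)) W = dim W := by
  have h : IsTransparent (𝟙_ (XRep k X)) := fun Y => by
    rw [braiding_tensorUnit_right, braiding_inv_tensorUnit_left]
  rw [sEntry_of_isTransparent h, dim_unit, one_mul]

theorem sEntry_comm (V W : XRep k X) : sEntry V W = sEntry W V := by
  rw [sEntry, sEntry, scalar_trace, scalar_trace, comp_lin, comp_lin, LinearMap.trace_comp_comm']

/-! ### The projection onto the transparent part -/

open Classical in
/-- The projection `τ_V = |X₂|⁻¹ ∑ P(m) Q(∂ n)`, over `m` in `ker ∂` and `n` in `X₂`, onto the part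
of `V` with degrees in `ker ∂` on which the image of `∂` acts trivially. -/
noncomputable def transparentProj (V : XRep k X) : Module.End k V.V :=
  (Fintype.card X₂ : k)⁻¹ • ∑ m with X.bdry m = 1, ∑ n, V.P m * V.Q (X.bdry n)

theorem P_commute_Q_bdry (V : XRep k X) {m : X₂} (hm : X.bdry m = 1) (n : X₂) :
    V.P m * V.Q (X.bdry n) = V.Q (X.bdry n) * V.P m := by
  rw [V.P_mul_Q, X.act_bdry, X.conj_of_bdry_eq_one hm]

theorem P_mul_P (V : XRep k X) [DecidableEq X₂] (m n : X₂) :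
    V.P m * V.P n = if m = n then V.P m else 0 := by
  split_ifs with h
  · subst h; exact V.P_mul_self m
  · exact V.P_mul_of_ne m n h

theorem Q_bdry_mul_transparentProj (V : XRep k X) (l : X₂) :
    V.Q (X.bdry l) * transparentProj V = transparentProj V := by
  classical
  rw [transparentProj, mul_smul_comm, Finset.mul_sum]
  congr 1
  refine Finset.sum_congr rfl fun m hm => ?_
  rw [Finset.mul_sum]
  refine Fintype.sum_equiv (Equiv.mulLeft l) _ _ fun n => ?_
  rw [← mul_assoc, ← P_commute_Q_bdry V (Finset.mem_filter.1 hm).2, mul_assoc, ← map_mul,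
    ← map_mul, Equiv.coe_mulLeft]

theorem P_mul_transparentProj_of_ne (V : XRep k X) {l : X₂} (hl : X.bdry l ≠ 1) :
    V.P l * transparentProj V = 0 := by
  classical
  rw [transparentProj, mul_smul_comm, Finset.mul_sum, Finset.sum_eq_zero, smul_zero]
  intro m hm
  rw [Finset.mul_sum]
  refine Finset.sum_eq_zero fun n _ => ?_
  have h : l ≠ m := by
    rintro rfl
    exact hl (Finset.mem_filter.1 hm).2
  rw [← mul_assoc, V.P_mul_of_ne _ _ h, zero_mul]

theorem transparentProj_mul_P_of_ne (V : XRep k X) {l : X₂} (hl : X.bdry l ≠ 1) :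
    transparentProj V * V.P l = 0 := by
  classical
  rw [transparentProj, smul_mul_assoc, Finset.sum_mul, Finset.sum_eq_zero, smul_zero]
  intro m hm
  rw [Finset.sum_mul]
  refine Finset.sum_eq_zero fun n _ => ?_
  have h : m ≠ l := by
    rintro rfl
    exact hl (Finset.mem_filter.1 hm).2
  rw [P_commute_Q_bdry V (Finset.mem_filter.1 hm).2, mul_assoc, V.P_mul_of_ne _ _ h, mul_zero]

theorem transparentProj_mul_P (V : XRep k X) (l : X₂) :
    transparentProj V * V.P l = V.P l * transparentProj V := by
  classical
  by_cases hl : X.bdry l = 1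
  · simp only [transparentProj, smul_mul_assoc, mul_smul_comm, Finset.mul_sum, Finset.sum_mul]
    congr 1
    refine Finset.sum_congr rfl fun m _ => Finset.sum_congr rfl fun n _ => ?_
    rw [mul_assoc, ← P_commute_Q_bdry V hl, ← mul_assoc, ← mul_assoc, P_mul_P, P_mul_P]
    by_cases h : m = l
    · simp [h]
    · simp [h, Ne.symm h]
  · rw [transparentProj_mul_P_of_ne V hl, P_mul_transparentProj_of_ne V hl]

theorem transparentProj_mul_Q (V : XRep k X) (g : X₁) :
    transparentProj V * V.Q g = V.Q g * transparentProj V := by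
  classical
  simp only [transparentProj, smul_mul_assoc, mul_smul_comm, Finset.mul_sum, Finset.sum_mul]
  congr 1
  refine Finset.sum_equiv (X.actEquiv g) (by simp [X.bdry_act_eq_one_iff]) fun m _ =>
    Fintype.sum_equiv (X.actEquiv g) _ _ fun n => ?_
  rw [X.actEquiv_apply, X.actEquiv_apply, ← mul_assoc, ← V.P_mul_Q, mul_assoc, mul_assoc,
    ← map_mul, ← map_mul, X.bdry_act]
  simp [mul_assoc]

/-- `τ_V` as an endomorphism in the category. -/
noncomputable def transparentProjHom (V : XRep k X) : V ⟶ V where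
  lin := transparentProj V
  map_P m v := LinearMap.congr_fun (transparentProj_mul_P V m) v
  map_Q g v := LinearMap.congr_fun (transparentProj_mul_Q V g) v

theorem isIdempotentElem_transparentProj [CharZero k] (V : XRep k X) :
    IsIdempotentElem (transparentProj V) := by
  classical
  have h : ∀ m, X.bdry m = 1 → V.P m * transparentProj V =
      (Fintype.card X₂ : k)⁻¹ • ∑ n, V.P m * V.Q (X.bdry n) := by
    intro m hm
    rw [transparentProj, mul_smul_comm, Finset.mul_sum, Finset.sum_eq_single m]
    · simp_rw [Finset.mul_sum, ← mul_assoc, V.P_mul_self]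
    · intro b _ hb
      simp_rw [Finset.mul_sum, ← mul_assoc, V.P_mul_of_ne _ _ hb.symm]
      simp
    · intro hm'
      simp [hm] at hm'
  have hX : (Fintype.card X₂ : k) ≠ 0 := Nat.cast_ne_zero.2 Fintype.card_ne_zero
  rw [IsIdempotentElem]
  nth_rw 1 [transparentProj]
  rw [smul_mul_assoc, Finset.sum_mul]
  simp_rw [Finset.sum_mul, mul_assoc, Q_bdry_mul_transparentProj]
  conv_rhs => rw [transparentProj, Finset.smul_sum]
  rw [Finset.smul_sum]
  refine Finset.sum_congr rfl fun m hm => ?_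
  rw [h m (Finset.mem_filter.1 hm).2, Finset.sum_const, Finset.card_univ, ← Nat.cast_smul_eq_nsmul k, smul_smul,
    inv_mul_cancel₀ hX, one_smul]

open Classical in
theorem trace_transparentProj (V : XRep k X) :
    LinearMap.trace k V.V (transparentProj V) =
      (Fintype.card X₂ : k)⁻¹ * ∑ m with X.bdry m = 1, ∑ n, character V m (X.bdry n) := by
  rw [transparentProj, map_smul, smul_eq_mul]
  simp only [map_sum]
  rfl

/-- In characteristic zero an idempotent whose trace is the dimension is the identity. -/
theorem transparentProj_eq_one_of_trace [CharZero k] (V : XRep k X)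
    (h : LinearMap.trace k V.V (transparentProj V) = dim V) : transparentProj V = 1 := by
  have h1 : LinearMap.trace k V.V (1 - transparentProj V) = 0 := by
    rw [map_sub, LinearMap.trace_one, h, dim_eq_finrank, sub_self]
  exact (sub_eq_zero.1 ((LinearMap.IsIdempotentElem.trace_eq_zero_iff
    (isIdempotentElem_transparentProj V).one_sub).1 h1)).symm

theorem P_eq_zero_of_transparentProj {V : XRep k X} (h : transparentProj V = 1) {m : X₂}
    (hm : X.bdry m ≠ 1) : V.P m = 0 := by
  have := P_mul_transparentProj_of_ne V hm
  rwa [h, mul_one] at this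

theorem Q_bdry_eq_one_of_transparentProj {V : XRep k X} (h : transparentProj V = 1) (n : X₂) :
    V.Q (X.bdry n) = 1 := by
  have := Q_bdry_mul_transparentProj V n
  rwa [h, mul_one] at this

theorem isTransparent_of_transparentProj {V : XRep k X} (h : transparentProj V = 1) :
    IsTransparent V := by
  intro Y
  apply hom_ext
  apply tensor_ext Y V
  intro n m y v hy hv
  change braidLin Y V (y ⊗ₜ v) = braidInvLin V Y (y ⊗ₜ v)
  rw [braidLin_homog Y V hy, braidInvLin_homog V Y hv, Q_bdry_eq_one_of_transparentProj h]
  by_cases hm : X.bdry m = 1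
  · simp [hm]
  · have hv0 : v = 0 := by
      rw [← hv, P_eq_zero_of_transparentProj h hm, LinearMap.zero_apply]
    simp [hv0]

theorem twist_eq_id_of_transparentProj {V : XRep k X} (h : transparentProj V = 1) :
    (RibbonCategory.twist V).hom = 𝟙 V := by
  apply hom_ext
  change twistLin V = 1
  rw [twistLin]
  simp_rw [Q_bdry_eq_one_of_transparentProj h, mul_one]
  exact V.sum_P

/-! ### The regular object -/

section Regular

theorem trace_pi_eq_sum {ι : Type*} [Fintype ι] [DecidableEq ι] (f : Module.End k (ι → k)) :
    LinearMap.trace k (ι → k) f = ∑ i, f (Pi.single i 1) i := by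
  rw [LinearMap.trace_eq_matrix_trace k (Pi.basisFun k ι)]
  simp [Matrix.trace]

variable (k X) [Fintype X₁]

/-- An enumeration of `X₂ × X₁` by an index type in `Type`. It keeps the space of functions on
`X₂ × X₁` in the universe of `k`. -/
noncomputable def regularIndex (X₁ : Type v₁) (X₂ : Type v₂) [Fintype X₁] [Fintype X₂] :
    Fin (Fintype.card (X₂ × X₁)) ≃ X₂ × X₁ :=
  (Fintype.equivFin (X₂ × X₁)).symm

open Classical in
/-- The regular object: the functions `f` on `X₂ × X₁`, where `P(m)` restricts `f` to `{m} × X₁` and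
`(Q(h) f)(n, g) = f(n ^ h, h⁻¹ g)`. -/
noncomputable def regular : XRep k X where
  V := Fin (Fintype.card (X₂ × X₁)) → k
  P m :=
    { toFun := fun f i => if (regularIndex X₁ X₂ i).1 = m then f i else 0
      map_add' := fun f f' => by funext i; by_cases h : (regularIndex X₁ X₂ i).1 = m <;> simp [h]
      map_smul' := fun c f => by funext i; simp }
  Q :=
    { toFun := fun h => LinearMap.funLeft k k fun i =>
        (regularIndex X₁ X₂).symm
          (X.act (regularIndex X₁ X₂ i).1 h, h⁻¹ * (regularIndex X₁ X₂ i).2)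
      map_one' := by
        ext f i
        simp [LinearMap.funLeft_apply, X.act_one]
      map_mul' := fun g h => by
        ext f i
        simp [LinearMap.funLeft_apply, X.act_mul, mul_assoc] }
  P_mul_self m := by
    ext f i
    by_cases h : (regularIndex X₁ X₂ i).1 = m <;> simp [h]
  P_mul_of_ne m n hmn := by
    ext f i
    by_cases h : (regularIndex X₁ X₂ i).1 = m
    · simp [h, hmn]
    · simp [h]
  sum_P := by
    ext f i
    simp [Finset.sum_apply]
  P_mul_Q m g := by
    have hinj : ∀ n, X.act n g = X.act m g ↔ n = m := fun n => (X.actEquiv g).injective.eq_iff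
    ext f i
    simp [LinearMap.funLeft_apply, hinj]

open Classical in
theorem character_regular (m : X₂) (g : X₁) :
    character (regular k X) m g = if g = 1 then (Fintype.card X₁ : k) else 0 := by
  have key : ∀ i, ((regular k X).P m * (regular k X).Q g) (Pi.single i (1 : k)) i =
      if (regularIndex X₁ X₂ i).1 = m ∧ g = 1 then 1 else 0 := by
    intro i
    have hi : (regularIndex X₁ X₂).symm
        (X.act (regularIndex X₁ X₂ i).1 g, g⁻¹ * (regularIndex X₁ X₂ i).2) = i ↔ g = 1 := by
      rw [Equiv.symm_apply_eq]
      constructor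
      · intro h
        have := congrArg Prod.snd h
        simpa using this
      · rintro rfl
        simp [X.act_one]
    change (if _ then LinearMap.funLeft k k _ (Pi.single i (1 : k)) i else 0) = _
    rw [LinearMap.funLeft_apply, Pi.single_apply]
    simp only [hi, ite_and]
  have htr : character (regular k X) m g =
      ∑ i, ((regular k X).P m * (regular k X).Q g) (Pi.single i (1 : k)) i := by
    exact trace_pi_eq_sum (k := k) _
  rw [htr, Finset.sum_congr rfl fun i _ => key i]
  by_cases hg : g = 1
  · simp only [hg, and_true, if_true]
    rw [Fintype.sum_equiv (regularIndex X₁ X₂) _ (fun p => if p.1 = m then (1 : k) else 0)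
      fun _ => rfl, Fintype.sum_prod_type, Finset.sum_eq_single m]
    · simp
    · intro b _ hb
      simp [hb]
    · simp
  · simp [hg]

theorem dim_regular : dim (regular k X) = Fintype.card X₂ * Fintype.card X₁ := by
  simp [dim_eq_sum_character, character_regular]

variable {k X}

open Classical in
/-- Pairing with the regular object computes the trace of the projection onto the transparent
part. -/
theorem sEntry_regular [CharZero k] (V : XRep k X) :
    sEntry V (regular k X) =
      LinearMap.trace k V.V (transparentProj V) * dim (regular k X) := by
  have hX : (Fintype.card X₂ : k) ≠ 0 := Nat.cast_ne_zero.2 Fintype.card_ne_zero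
  have h : ∀ m : X₂, ∑ n, character V m (X.bdry (m * n * m⁻¹)) *
      character (regular k X) n (X.bdry m) = if X.bdry m = 1 then
        (∑ n, character V m (X.bdry n)) * (Fintype.card X₁ : k) else 0 := by
    intro m
    simp only [character_regular, mul_ite, mul_zero]
    split_ifs with hm
    · rw [← Finset.sum_mul]
      congr 1
      exact Fintype.sum_equiv (MulAut.conj m).toEquiv _ _ fun n => rfl
    · simp
  rw [sEntry_eq_sum_character, Finset.sum_congr rfl fun m _ => h m, ← Finset.sum_filter,
    ← Finset.sum_mul, trace_transparentProj, dim_regular]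
  field_simp

/-- An object whose pairing with the regular object is that of a multiple of the unit is
transparent. -/
theorem transparentProj_eq_one_of_sEntry [CharZero k] {V : XRep k X}
    (h : sEntry V (regular k X) = dim V * dim (regular k X)) : transparentProj V = 1 := by
  have hR : dim (regular k X) ≠ 0 := by
    rw [dim_regular, ← Nat.cast_mul]
    exact Nat.cast_ne_zero.2 (mul_ne_zero Fintype.card_ne_zero Fintype.card_ne_zero)
  rw [sEntry_regular] at h
  exact transparentProj_eq_one_of_trace V (mul_right_cancel₀ hR h)

/-- The regular object alone detects transparency. -/
theorem isTransparent_iff [CharZero k] (V : XRep k X) :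
    IsTransparent V ↔ transparentProj V = 1 :=
  ⟨fun h => transparentProj_eq_one_of_sEntry (sEntry_of_isTransparent h _),
    isTransparent_of_transparentProj⟩

/-- By the character of `R` the trace is `|ker ∂|² |X₁| / |X₂|`, where `|X₂| = |Im ∂| |ker ∂|` and
`|X₁| = |coker ∂| |Im ∂|`. -/
theorem trace_transparentProj_regular [CharZero k] :
    LinearMap.trace k (regular k X).V (transparentProj (regular k X)) =
      ((Nat.card X.bdry.ker * Nat.card (X₁ ⧸ X.bdry.range) : ℕ) : k) := by
  classical
  have hk : ({m | X.bdry m = 1} : Finset X₂).card = Nat.card X.bdry.ker := by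
    rw [← Fintype.card_subtype, ← Nat.card_eq_fintype_card]
    rfl
  have h1 : Nat.card X.bdry.range * Nat.card X.bdry.ker = Fintype.card X₂ := by
    rw [← Nat.card_eq_fintype_card, Subgroup.card_eq_card_quotient_mul_card_subgroup X.bdry.ker,
      Nat.card_congr (QuotientGroup.quotientKerEquivRange X.bdry).toEquiv]
  have h2 : Nat.card (X₁ ⧸ X.bdry.range) * Nat.card X.bdry.range = Fintype.card X₁ := by
    rw [← Nat.card_eq_fintype_card, ← Subgroup.card_eq_card_quotient_mul_card_subgroup]
  have h3 : (Nat.card X.bdry.range : k) ≠ 0 := Nat.cast_ne_zero.2 Nat.card_pos.ne'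
  have h4 : (Nat.card X.bdry.ker : k) ≠ 0 := Nat.cast_ne_zero.2 Nat.card_pos.ne'
  rw [trace_transparentProj]
  simp only [character_regular, Finset.sum_const, ← Finset.sum_filter, hk, nsmul_eq_mul]
  rw [← h1, ← h2]
  push_cast
  field_simp

end Regular

/-! ### Subobjects and quotients -/

/-- A subspace stable under the projections and the action. -/
structure IsSubrep (V : XRep k X) (U : Submodule k V.V) : Prop where
  P_mem : ∀ m, ∀ v ∈ U, V.P m v ∈ U
  Q_mem : ∀ g, ∀ v ∈ U, V.Q g v ∈ U

/-- The object on a stable subspace. -/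
abbrev sub (V : XRep k X) (U : Submodule k V.V) (hU : IsSubrep V U) : XRep k X where
  V := U
  P m := (V.P m).restrict (hU.P_mem m)
  Q :=
    { toFun := fun g => (V.Q g).restrict (hU.Q_mem g)
      map_one' := by ext; simp
      map_mul' := fun g h => by ext; simp }
  P_mul_self m := by ext; simp
  P_mul_of_ne m n h := by ext; simp [V.P_P_of_ne h]
  sum_P := by
    ext v
    simp [LinearMap.sum_apply, V.sum_P_apply]
  P_mul_Q m g := by ext; simp [P_Q]

/-- The quotient object by a stable subspace. -/
abbrev quot (V : XRep k X) (U : Submodule k V.V) (hU : IsSubrep V U) : XRep k X where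
  V := V.V ⧸ U
  P m := U.mapQ U (V.P m) (hU.P_mem m)
  Q :=
    { toFun := fun g => U.mapQ U (V.Q g) (hU.Q_mem g)
      map_one' := by ext; simp
      map_mul' := fun g h => by ext; simp }
  P_mul_self m := by ext; simp
  P_mul_of_ne m n h := by ext; simp [V.P_P_of_ne h]
  sum_P := by
    ext v
    have h : ∑ m, U.mkQ (V.P m v) = U.mkQ v := by rw [← map_sum, V.sum_P_apply]
    simpa [LinearMap.sum_apply] using h
  P_mul_Q m g := by ext; simp [P_Q]

/-- The trace is additive along an invariant subspace. -/
theorem trace_eq_restrict_add_mapQ {E : Type*} [AddCommGroup E] [Module k E] [Module.Finite k E]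
    (U : Submodule k E) (f : Module.End k E) (hf : ∀ v ∈ U, f v ∈ U) :
    LinearMap.trace k E f =
      LinearMap.trace k U (f.restrict hf) + LinearMap.trace k (E ⧸ U) (U.mapQ U f hf) := by
  -- With a retraction `r` onto `U` and the section `s` of the quotient map that it determines,
  -- `f = f ∘ ι ∘ r + f ∘ s ∘ q`, and both traces can be cycled.
  obtain ⟨r, hr⟩ := U.subtype.exists_leftInverse_of_injective U.ker_subtype
  have hr' : ∀ u : U, r u = u := fun u => LinearMap.congr_fun hr u
  let s : E ⧸ U →ₗ[k] E := U.liftQ (LinearMap.id - U.subtype ∘ₗ r) fun u hu => by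
    simp [hr' ⟨u, hu⟩]
  have hs : ∀ v, s (U.mkQ v) = v - r v := fun v => rfl
  have h1 : f = (f ∘ₗ U.subtype) ∘ₗ r + (f ∘ₗ s) ∘ₗ U.mkQ := by
    ext v
    simp only [LinearMap.add_apply, LinearMap.comp_apply, hs, map_sub, Submodule.subtype_apply]
    abel
  have h2 : r ∘ₗ f ∘ₗ U.subtype = f.restrict hf := by
    ext u
    exact congrArg Subtype.val (hr' ⟨f u, hf u u.2⟩)
  have h3 : U.mkQ ∘ₗ f ∘ₗ s = U.mapQ U f hf := by
    apply Submodule.linearMap_qext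
    ext v
    have hv : U.mkQ (f (r v)) = 0 := (Submodule.Quotient.mk_eq_zero U).2 (hf _ (r v).2)
    change U.mkQ (f (s (U.mkQ v))) = U.mkQ (f v)
    rw [hs, map_sub, map_sub, hv, sub_zero]
  conv_lhs => rw [h1]
  rw [map_add, LinearMap.trace_comp_comm' r, LinearMap.trace_comp_comm' U.mkQ, h2, h3]

theorem character_eq_sub_add_quot (V : XRep k X) (U : Submodule k V.V) (hU : IsSubrep V U)
    (m : X₂) (g : X₁) :
    character V m g = character (sub V U hU) m g + character (quot V U hU) m g := by
  refine (trace_eq_restrict_add_mapQ U (V.P m * V.Q g)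
    fun v hv => hU.P_mem m _ (hU.Q_mem g v hv)).trans ?_
  rw [character, character]
  congr 2
  ext v
  rfl

theorem isSubrep_ker {V W : XRep k X} (f : V ⟶ W) : IsSubrep V (LinearMap.ker f.lin) where
  P_mem m v hv := by
    rw [LinearMap.mem_ker] at hv ⊢
    rw [f.map_P, hv, map_zero]
  Q_mem g v hv := by
    rw [LinearMap.mem_ker] at hv ⊢
    rw [f.map_Q, hv, map_zero]

theorem isSubrep_range {V W : XRep k X} (f : V ⟶ W) : IsSubrep W (LinearMap.range f.lin) where
  P_mem m := by
    rintro _ ⟨v, rfl⟩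
    exact ⟨V.P m v, f.map_P m v⟩
  Q_mem g := by
    rintro _ ⟨v, rfl⟩
    exact ⟨V.Q g v, f.map_Q g v⟩

/-- The inclusion of a stable subspace. -/
def subHom (V : XRep k X) (U : Submodule k V.V) (hU : IsSubrep V U) : sub V U hU ⟶ V where
  lin := U.subtype
  map_P _ _ := rfl
  map_Q _ _ := rfl

theorem mono_of_injective {V W : XRep k X} (f : V ⟶ W) (hf : Function.Injective f.lin) :
    Mono f where
  right_cancellation g h e := by
    ext v
    exact hf (LinearMap.congr_fun (congrArg Hom.lin e) v)

theorem ker_eq_bot_of_mono {V W : XRep k X} (f : V ⟶ W) [Mono f] : LinearMap.ker f.lin = ⊥ := by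
  have h : subHom V _ (isSubrep_ker f) ≫ f = 0 ≫ f := by
    rw [Limits.zero_comp]
    ext v
    exact LinearMap.mem_ker.1 v.2
  rw [cancel_mono] at h
  rw [eq_bot_iff]
  intro v hv
  exact LinearMap.congr_fun (congrArg Hom.lin h) ⟨v, hv⟩

/-- A morphism that is bijective is an isomorphism. -/
noncomputable def isoOfBijective {V W : XRep k X} (f : V ⟶ W) (h₁ : LinearMap.ker f.lin = ⊥)
    (h₂ : LinearMap.range f.lin = ⊤) : V ≅ W :=
  let e := LinearEquiv.ofBijective f.lin ⟨LinearMap.ker_eq_bot.1 h₁, LinearMap.range_eq_top.1 h₂⟩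
  isoMk f e.symm.toLinearMap e.symm_apply_apply e.apply_symm_apply

/-- Simplicity in terms of stable subspaces. -/
theorem simple_iff (V : XRep k X) :
    Simple V ↔ Nontrivial V.V ∧ ∀ U, IsSubrep V U → U = ⊥ ∨ U = ⊤ := by
  constructor
  · intro hV
    have hne : (𝟙 V : V ⟶ V) ≠ 0 := id_nonzero V
    refine ⟨?_, fun U hU => ?_⟩
    · by_contra h
      rw [not_nontrivial_iff_subsingleton] at h
      exact hne (by ext v; exact Subsingleton.elim _ _)
    · by_cases h : subHom V U hU = 0
      · left
        rw [eq_bot_iff]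
        intro v hv
        exact LinearMap.congr_fun (congrArg Hom.lin h) ⟨v, hv⟩
      · right
        have := mono_of_injective (subHom V U hU) Subtype.val_injective
        have hi := isIso_of_mono_of_nonzero h
        rw [eq_top_iff]
        intro v _
        have hv : U.subtype ((inv (subHom V U hU)).lin v) = v :=
          LinearMap.congr_fun (congrArg Hom.lin (IsIso.inv_hom_id (subHom V U hU))) v
        rw [← hv]
        exact Subtype.property _
  · rintro ⟨hn, hU⟩
    refine ⟨fun {Y} f _ => ⟨fun hi hf => ?_, fun hf => ?_⟩⟩
    · obtain ⟨v, hv⟩ := exists_ne (0 : V.V)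
      apply hv
      have h : f.lin ((inv f).lin v) = v :=
        LinearMap.congr_fun (congrArg Hom.lin (IsIso.inv_hom_id f)) v
      rw [← h]
      exact LinearMap.congr_fun (congrArg Hom.lin hf) _
    · refine (isoOfBijective f (ker_eq_bot_of_mono f) ?_).isIso_hom
      refine (hU _ (isSubrep_range f)).resolve_left fun h => hf ?_
      ext v
      exact LinearMap.congr_fun (LinearMap.range_eq_bot.1 h) v

/-- Every character is the sum of the characters of the members of a finite family of simple
objects, with repetitions: the composition factors. -/
theorem exists_simple_decomposition (V : XRep k X) :
    ∃ L : List (XRep k X), (∀ S ∈ L, Simple S) ∧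
      ∀ m g, character V m g = (L.map fun S => character S m g).sum := by
  induction h : Module.finrank k V.V using Nat.strong_induction_on generalizing V with
  | _ n ih =>
    by_cases hs : Simple V
    · exact ⟨[V], by simpa using hs, by simp⟩
    · rw [simple_iff, not_and_or, not_nontrivial_iff_subsingleton] at hs
      rcases hs with hs | hs
      · refine ⟨[], by simp, fun m g => ?_⟩
        have h0 : V.P m * V.Q g = 0 := by
          ext v
          exact Subsingleton.elim _ _
        rw [character, h0, map_zero, List.map_nil, List.sum_nil]
      · push Not at hs
        obtain ⟨U, hU, h₁, h₂⟩ := hs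
        have hadd := U.finrank_quotient_add_finrank
        have hlt := Submodule.finrank_lt h₂
        have hpos : Module.finrank k U ≠ 0 := fun h0 => h₁ (Submodule.finrank_eq_zero.1 h0)
        obtain ⟨L₁, hL₁, hc₁⟩ := ih _ (show Module.finrank k U < n by omega) (sub V U hU) rfl
        obtain ⟨L₂, hL₂, hc₂⟩ := ih _ (show Module.finrank k (V.V ⧸ U) < n by omega) (quot V U hU) rfl
        refine ⟨L₁ ++ L₂, fun S hS => (List.mem_append.1 hS).elim (hL₁ S) (hL₂ S), fun m g => ?_⟩
        rw [character_eq_sub_add_quot V U hU, hc₁, hc₂, List.map_append, List.sum_append]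

/-! ### Orthogonality of characters -/

/-- The linear map `f ↦ A ∘ f ∘ B`. -/
def sandwich {E F : Type*} [AddCommGroup E] [Module k E] [AddCommGroup F] [Module k F]
    (A : Module.End k F) (B : Module.End k E) : Module.End k (E →ₗ[k] F) where
  toFun f := A ∘ₗ f ∘ₗ B
  map_add' f g := by ext; simp
  map_smul' c f := by ext; simp

theorem trace_eq_of_equiv {E F : Type*} [AddCommGroup E] [Module k E] [AddCommGroup F] [Module k F]
    (e : E ≃ₗ[k] F) (f : Module.End k E) (g : Module.End k F) (h : ∀ x, g (e x) = e (f x)) :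
    LinearMap.trace k F g = LinearMap.trace k E f := by
  rw [← LinearMap.trace_conj' f e]
  congr 1
  ext y
  rw [LinearEquiv.conj_apply_apply, ← h, LinearEquiv.apply_symm_apply]

/-- Under `Hom(E, F) ≃ E* ⊗ F` the map `f ↦ A ∘ f ∘ B` is `B* ⊗ A`. -/
theorem trace_sandwich {E F : Type*} [AddCommGroup E] [Module k E] [Module.Finite k E]
    [AddCommGroup F] [Module k F] [Module.Finite k F] (A : Module.End k F) (B : Module.End k E) :
    LinearMap.trace k (E →ₗ[k] F) (sandwich A B) =
      LinearMap.trace k E B * LinearMap.trace k F A := by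
  have h : sandwich A B ∘ₗ (dualTensorHomEquiv k E F).toLinearMap =
      (dualTensorHomEquiv k E F).toLinearMap ∘ₗ
        TensorProduct.map (Module.Dual.transpose B) A := by
    ext φ w v
    simp [sandwich, Module.Dual.transpose_apply]
  have ht := LinearMap.trace_tensorProduct' (Module.Dual.transpose B) A
  rw [LinearMap.trace_transpose'] at ht
  rw [← ht]
  exact trace_eq_of_equiv (E := Module.Dual k E ⊗[k] F) (F := E →ₗ[k] F)
    (dualTensorHomEquiv k E F) _ _ (LinearMap.congr_fun h)

/-- The space of morphisms, as a subspace of the space of linear maps. -/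
def homSubmodule (V W : XRep k X) : Submodule k (V.V →ₗ[k] W.V) where
  carrier := {f | (∀ m, f ∘ₗ V.P m = W.P m ∘ₗ f) ∧ ∀ g, f ∘ₗ V.Q g = W.Q g ∘ₗ f}
  zero_mem' := by simp
  add_mem' {f f'} hf hf' := by
    refine ⟨fun m => ?_, fun g => ?_⟩
    · rw [LinearMap.add_comp, LinearMap.comp_add, hf.1, hf'.1]
    · rw [LinearMap.add_comp, LinearMap.comp_add, hf.2, hf'.2]
  smul_mem' c f hf := by
    refine ⟨fun m => ?_, fun g => ?_⟩
    · rw [LinearMap.smul_comp, LinearMap.comp_smul, hf.1]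
    · rw [LinearMap.smul_comp, LinearMap.comp_smul, hf.2]

/-- The morphism with a given underlying linear map in `homSubmodule V W`. -/
def homOfMem {V W : XRep k X} {f : V.V →ₗ[k] W.V} (hf : f ∈ homSubmodule V W) : V ⟶ W where
  lin := f
  map_P m v := LinearMap.congr_fun (hf.1 m) v
  map_Q g v := LinearMap.congr_fun (hf.2 g) v

/-- The averaging operator on linear maps, whose image is the space of morphisms:
`f ↦ |X₁|⁻¹ ∑ Q(g) P(m) f P(m) Q(g⁻¹)`. -/
noncomputable def averageHom [Fintype X₁] (V W : XRep k X) : Module.End k (V.V →ₗ[k] W.V) :=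
  (Fintype.card X₁ : k)⁻¹ • ∑ g, ∑ m, sandwich (W.Q g * W.P m) (V.P m * V.Q g⁻¹)

theorem averageHom_apply [Fintype X₁] (V W : XRep k X) (f : V.V →ₗ[k] W.V) (v : V.V) :
    averageHom V W f v = (Fintype.card X₁ : k)⁻¹ •
      ∑ g, ∑ m, W.Q g (W.P m (f (V.P m (V.Q g⁻¹ v)))) := by
  simp [averageHom, sandwich, LinearMap.sum_apply]

theorem isProj_averageHom [CharZero k] [Fintype X₁] (V W : XRep k X) :
    LinearMap.IsProj (homSubmodule V W) (averageHom V W) where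
  map_mem f := by
    classical
    refine ⟨fun l => ?_, fun h => ?_⟩
    · ext v
      rw [LinearMap.comp_apply, LinearMap.comp_apply, averageHom_apply, averageHom_apply, map_smul,
        map_sum]
      congr 1
      refine Finset.sum_congr rfl fun g _ => ?_
      rw [map_sum, Finset.sum_eq_single (X.act l g), Finset.sum_eq_single (X.act l g)]
      · have h1 : V.Q g⁻¹ (V.P l v) = V.P (X.act l g) (V.Q g⁻¹ v) := by
          rw [P_Q, X.act_act_inv]
        rw [h1, P_P_self, W.P_Q, P_P_self]
      · intro m _ hm
        rw [P_Q, W.P_P_of_ne hm.symm, map_zero]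
      · simp
      · intro m _ hm
        have h1 : V.Q g⁻¹ (V.P l v) = V.P (X.act l g) (V.Q g⁻¹ v) := by
          rw [P_Q, X.act_act_inv]
        rw [h1, V.P_P_of_ne hm, map_zero, map_zero, map_zero]
      · simp
    · ext v
      rw [LinearMap.comp_apply, LinearMap.comp_apply, averageHom_apply, averageHom_apply, map_smul,
        map_sum]
      congr 1
      refine Fintype.sum_equiv (Equiv.mulLeft h⁻¹) _ _ fun g => ?_
      rw [map_sum]
      refine Finset.sum_congr rfl fun m _ => ?_
      rw [Equiv.coe_mulLeft, Q_mul, Q_mul, mul_inv_cancel_left, mul_inv_rev, inv_inv]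
  map_id f hf := by
    have hX : (Fintype.card X₁ : k) ≠ 0 := Nat.cast_ne_zero.2 Fintype.card_ne_zero
    have hP : ∀ m v, W.P m (f v) = f (V.P m v) := fun m v => (LinearMap.congr_fun (hf.1 m) v).symm
    have hQ : ∀ g v, W.Q g (f v) = f (V.Q g v) := fun g v => (LinearMap.congr_fun (hf.2 g) v).symm
    ext v
    rw [averageHom_apply]
    have h : ∀ g : X₁, ∑ m, W.Q g (W.P m (f (V.P m (V.Q g⁻¹ v)))) = f v := by
      intro g
      simp_rw [hP, P_P_self, hQ]
      rw [← map_sum, ← map_sum, V.sum_P_apply, Q_Q_inv]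
    simp_rw [h]
    rw [Finset.sum_const, Finset.card_univ, ← Nat.cast_smul_eq_nsmul k, smul_smul,
      inv_mul_cancel₀ hX, one_smul]

/-- The trace of a projection is the dimension of its image, and the trace of `f ↦ A ∘ f ∘ B` is
`tr A · tr B`. -/
theorem sum_character_mul_character [CharZero k] [Fintype X₁] (V W : XRep k X) :
    (Fintype.card X₁ : k)⁻¹ * ∑ g, ∑ m, character V m g⁻¹ * character W m g =
      (Module.finrank k (homSubmodule V W) : k) := by
  rw [← (isProj_averageHom V W).trace, averageHom, map_smul, smul_eq_mul]
  simp only [map_sum, trace_sandwich]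
  congr 1
  refine Finset.sum_congr rfl fun g _ => Finset.sum_congr rfl fun m _ => ?_
  rw [LinearMap.trace_mul_comm k (W.Q g)]
  rfl

/-! ### Schur's lemma -/

theorem nonempty_iso_of_ne_zero {V W : XRep k X} (hV : Simple V) (hW : Simple W) {f : V ⟶ W}
    (hf : f ≠ 0) : Nonempty (V ≅ W) := by
  refine ⟨isoOfBijective f ?_ ?_⟩
  · refine (((simple_iff V).1 hV).2 _ (isSubrep_ker f)).resolve_right fun h => hf ?_
    ext v
    exact LinearMap.congr_fun (LinearMap.ker_eq_top.1 h) v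
  · refine (((simple_iff W).1 hW).2 _ (isSubrep_range f)).resolve_left fun h => hf ?_
    ext v
    exact LinearMap.congr_fun (LinearMap.range_eq_bot.1 h) v

theorem exists_lin_eq_smul [IsAlgClosed k] {V : XRep k X} (hV : Simple V) (f : V ⟶ V) :
    ∃ c : k, f.lin = c • LinearMap.id := by
  have hn := ((simple_iff V).1 hV).1
  obtain ⟨c, hc⟩ := Module.End.exists_eigenvalue (K := k) (V := V.V) f.lin
  obtain ⟨v, hv⟩ := hc.exists_hasEigenvector
  refine ⟨c, ?_⟩
  have hfv : f.lin v = c • v := hv.apply_eq_smul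
  have h0 : LinearMap.ker (f - c • 𝟙 V).lin = ⊤ := by
    refine (((simple_iff V).1 hV).2 _ (isSubrep_ker _)).resolve_left fun h => hv.2 ?_
    have hm : v ∈ LinearMap.ker (f - c • 𝟙 V).lin := by
      rw [LinearMap.mem_ker, sub_eq_add_neg]
      simp [hfv]
    rwa [h] at hm
  have h1 := LinearMap.ker_eq_top.1 h0
  rw [sub_eq_add_neg, add_lin, neg_lin, smul_lin, id_lin, ← sub_eq_add_neg, sub_eq_zero] at h1
  exact h1

theorem finrank_homSubmodule_self [IsAlgClosed k] {V : XRep k X} (hV : Simple V) :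
    Module.finrank k (homSubmodule V V) = 1 := by
  have hn := ((simple_iff V).1 hV).1
  have h : homSubmodule V V = Submodule.span k {LinearMap.id} := by
    apply le_antisymm
    · intro f hf
      obtain ⟨c, hc⟩ := exists_lin_eq_smul hV (homOfMem hf)
      exact Submodule.mem_span_singleton.2 ⟨c, hc.symm⟩
    · rw [Submodule.span_singleton_le_iff_mem]
      exact ⟨fun m => rfl, fun g => rfl⟩
  rw [h, finrank_span_singleton]
  exact one_ne_zero (α := Module.End k V.V)

theorem finrank_homSubmodule_of_not_iso {V W : XRep k X} (hV : Simple V) (hW : Simple W)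
    (h : ¬Nonempty (V ≅ W)) : Module.finrank k (homSubmodule V W) = 0 := by
  rw [Submodule.finrank_eq_zero, eq_bot_iff]
  intro f hf
  by_contra hne
  exact h (nonempty_iso_of_ne_zero hV hW (f := homOfMem hf) fun h0 => hne (congrArg Hom.lin h0))

open Classical in
/-- On a simple object `τ` has trace `dim V` or `0`, as `V` is transparent or not. -/
theorem trace_transparentProj_of_simple [IsAlgClosed k] [CharZero k] [Fintype X₁] {V : XRep k X}
    (hV : Simple V) : LinearMap.trace k V.V (transparentProj V) =
      if IsTransparent V then dim V else 0 := by
  have hn := ((simple_iff V).1 hV).1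
  split_ifs with h
  · rw [(isTransparent_iff V).1 h, LinearMap.trace_one, dim_eq_finrank]
  · obtain ⟨c, hc⟩ := exists_lin_eq_smul hV (transparentProjHom V)
    replace hc : transparentProj V = c • (1 : Module.End k V.V) := hc
    have hi := isIdempotentElem_transparentProj V
    rw [IsIdempotentElem, hc, smul_mul_smul_comm, one_mul] at hi
    have hcc : c * c = c := smul_left_injective k (one_ne_zero (α := Module.End k V.V)) hi
    rcases eq_or_ne c 0 with h0 | h0
    · rw [hc, h0, zero_smul, map_zero]
    · have h1 : c = 1 := mul_left_cancel₀ h0 (hcc.trans (mul_one c).symm)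
      exact absurd ((isTransparent_iff V).2 (by rw [hc, h1, one_smul])) h

/-! ### Isomorphism classes -/

/-- The character of an isomorphism class. -/
noncomputable def IsoClass.character : IsoClass k X → X₂ → X₁ → k :=
  Quotient.lift XRep.character fun _ _ ⟨e⟩ => character_congr e

theorem mk_mem_transparentClasses_iff [CharZero k] [Finite X₁] (V : XRep k X) :
    (Quotient.mk _ V : IsoClass k X) ∈ transparentClasses k X ↔ Simple V ∧ IsTransparent V := by
  constructor
  · rintro ⟨W, hW, hT, h⟩
    obtain ⟨e⟩ := Quotient.exact h
    cases nonempty_fintype X₁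
    refine ⟨Simple.of_iso e.symm, (isTransparent_iff V).2 ?_⟩
    apply transparentProj_eq_one_of_sEntry
    rw [← sEntry_congr e (Iso.refl _), sEntry_of_isTransparent hT, dim_congr e]
  · rintro ⟨h, hT⟩
    exact ⟨V, h, hT, rfl⟩

theorem transparentClasses_subset : transparentClasses k X ⊆ simpleClasses k X :=
  fun _ ⟨V, hV, _, h⟩ => ⟨V, hV, h⟩

open Classical in
theorem character_orthonormal [IsAlgClosed k] [CharZero k] [Fintype X₁] {p q : IsoClass k X}
    (hp : p ∈ simpleClasses k X) (hq : q ∈ simpleClasses k X) :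
    (Fintype.card X₁ : k)⁻¹ * ∑ g, ∑ m, p.character m g⁻¹ * q.character m g =
      if p = q then 1 else 0 := by
  split_ifs with h
  · subst h
    obtain ⟨V, hV, rfl⟩ := hp
    refine (sum_character_mul_character V V).trans ?_
    rw [finrank_homSubmodule_self hV, Nat.cast_one]
  · obtain ⟨V, hV, rfl⟩ := hp
    obtain ⟨W, hW, rfl⟩ := hq
    refine (sum_character_mul_character V W).trans ?_
    rw [finrank_homSubmodule_of_not_iso hV hW fun e => h (Quotient.sound e), Nat.cast_zero]

theorem dim_ne_zero [CharZero k] {p : IsoClass k X} (hp : p ∈ simpleClasses k X) : p.dim ≠ 0 := by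
  obtain ⟨V, hV, rfl⟩ := hp
  have hn := ((simple_iff V).1 hV).1
  change dim V ≠ 0
  rw [dim_eq_finrank]
  exact Nat.cast_ne_zero.2 Module.finrank_pos.ne'

theorem IsoClass.dim_eq_sum_character (p : IsoClass k X) : p.dim = ∑ m, p.character m 1 := by
  induction p using Quotient.inductionOn with
  | _ V => exact XRep.dim_eq_sum_character V

theorem IsoClass.s_eq_sum_character (p q : IsoClass k X) :
    p.s q = ∑ m, ∑ n, p.character m (X.bdry (m * n * m⁻¹)) * q.character n (X.bdry m) := by
  induction p, q using Quotient.inductionOn₂ with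
  | _ V W => exact sEntry_eq_sum_character V W

variable (k X) in
/-- The class of the regular object. -/
noncomputable def regularClass [Fintype X₁] : IsoClass k X := Quotient.mk _ (regular k X)

theorem _root_.Multiset.sum_map_ite_eq_count {α R : Type*} [DecidableEq α] [Semiring R]
    (s : Multiset α) (a : α) : (s.map fun b => if a = b then (1 : R) else 0).sum = s.count a := by
  induction s using Multiset.induction_on with
  | empty => simp
  | cons b s ih =>
    rw [Multiset.map_cons, Multiset.sum_cons, ih, Multiset.count_cons]
    split_ifs <;> simp [add_comm]

variable (k X) in
open Classical in
/-- Each simple class occurs in the regular object, with its dimension as multiplicity. -/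
theorem exists_regular_decomposition [IsAlgClosed k] [CharZero k] [Fintype X₁] :
    ∃ L : Multiset (IsoClass k X), (∀ p, p ∈ L ↔ p ∈ simpleClasses k X) ∧
      (∀ p ∈ simpleClasses k X, (L.count p : k) = p.dim) ∧
      ∀ m g, (regularClass k X).character m g = (L.map fun p => p.character m g).sum := by
  -- The composition factors `L` satisfy the character identity; pairing it with `χ_p` gives the
  -- multiplicity of `p` on one side and, as `χ_R` is supported at `g = 1`, the dimension `d_p` on
  -- the other. Since `d_p ≠ 0`, every simple class occurs.
  obtain ⟨L, hL, hc⟩ := exists_simple_decomposition (regular k X)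
  let L' : Multiset (IsoClass k X) := ((L.map (Quotient.mk _) : List (IsoClass k X)) : Multiset _)
  have hL' : ∀ p ∈ L', p ∈ simpleClasses k X := by
    intro p hp
    obtain ⟨S, hS, rfl⟩ := List.mem_map.1 (Multiset.mem_coe.1 hp)
    exact ⟨S, hL S hS, rfl⟩
  have hc' : ∀ m g, character (regular k X) m g = (L'.map fun p => p.character m g).sum := by
    intro m g
    rw [hc, Multiset.map_coe, Multiset.sum_coe, List.map_map]
    rfl
  have hX : (Fintype.card X₁ : k) ≠ 0 := Nat.cast_ne_zero.2 Fintype.card_ne_zero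
  have hcount : ∀ p ∈ simpleClasses k X, (L'.count p : k) = p.dim := by
    intro p hp
    have h1 : (Fintype.card X₁ : k)⁻¹ * ∑ g, ∑ m, p.character m g⁻¹ *
        character (regular k X) m g = p.dim := by
      simp only [character_regular, mul_ite, mul_zero]
      rw [Finset.sum_eq_single 1]
      · simp only [if_true, inv_one]
        rw [← Finset.sum_mul, ← IsoClass.dim_eq_sum_character, mul_comm, mul_assoc,
          mul_inv_cancel₀ hX, mul_one]
      · intro g _ hg
        simp [hg]
      · simp
    have h2 : (Fintype.card X₁ : k)⁻¹ * ∑ g, ∑ m, p.character m g⁻¹ *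
        character (regular k X) m g = (L'.map fun q => if p = q then (1 : k) else 0).sum := by
      rw [Multiset.map_congr rfl fun q hq => (character_orthonormal hp (hL' q hq)).symm,
        Multiset.sum_map_mul_left, Multiset.sum_map_sum]
      congr 1
      refine Finset.sum_congr rfl fun g _ => ?_
      rw [Multiset.sum_map_sum]
      refine Finset.sum_congr rfl fun m _ => ?_
      rw [Multiset.sum_map_mul_left, hc']
    rw [← h1, h2, Multiset.sum_map_ite_eq_count]
  refine ⟨L', fun p => ⟨hL' p, fun hp => ?_⟩, hcount, hc'⟩
  rw [← Multiset.count_ne_zero, ← Nat.cast_ne_zero (R := k), hcount p hp]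
  exact dim_ne_zero hp

/-! ### The three descriptions of the transparent classes -/

theorem simple_unit : Simple (𝟙_ (XRep k X)) :=
  (simple_iff _).2 ⟨inferInstanceAs (Nontrivial k),
    fun U _ => eq_bot_or_eq_top (α := Submodule k k) U⟩

theorem IsoClass.s_unitClass (q : IsoClass k X) : (unitClass k X).s q = q.dim := by
  induction q using Quotient.inductionOn with
  | _ W => exact sEntry_unit W

theorem IsoClass.s_comm (p q : IsoClass k X) : p.s q = q.s p := by
  induction p, q using Quotient.inductionOn₂ with
  | _ V W => exact sEntry_comm V W

theorem unitClass_mem : unitClass k X ∈ simpleClasses k X := ⟨_, simple_unit, rfl⟩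

theorem dim_unitClass : (unitClass k X).dim = 1 := by
  change dim (𝟙_ (XRep k X)) = 1
  rw [dim_unit]

/-- Evaluating at the column of the unit shows that the factor of proportionality is `d_p`. -/
theorem collinearClasses_eq_M : collinearClasses k X = M k X := by
  ext p
  refine and_congr_right fun hp => ⟨?_, fun h => ⟨p.dim, fun q hq => ?_⟩⟩
  · rintro ⟨α, hα⟩ q hq
    have h1 := hα _ unitClass_mem
    rw [IsoClass.s_comm, IsoClass.s_unitClass, IsoClass.s_unitClass, dim_unitClass, mul_one] at h1
    rw [hα q hq, IsoClass.s_unitClass, h1]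
  · rw [h q hq, IsoClass.s_unitClass]

theorem transparentClasses_subset_M : transparentClasses k X ⊆ M k X := by
  rintro _ ⟨V, hV, hT, rfl⟩
  refine ⟨⟨V, hV, rfl⟩, fun q _ => ?_⟩
  induction q using Quotient.inductionOn with
  | _ W => exact sEntry_of_isTransparent hT W

/-- If `s_{pq} = d_p d_q` for all simple classes `q`, the same holds, by additivity, with the
regular object in place of `q`. -/
theorem M_subset_transparentClasses [IsAlgClosed k] [CharZero k] [Fintype X₁] :
    M k X ⊆ transparentClasses k X := by
  rintro p ⟨hp, hs⟩
  obtain ⟨L, hL, -, hc⟩ := exists_regular_decomposition k X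
  have h1 : p.s (regularClass k X) = (L.map fun q => p.s q).sum := by
    simp only [IsoClass.s_eq_sum_character, hc, Multiset.sum_map_sum, Multiset.sum_map_mul_left]
  have h2 : (regularClass k X).dim = (L.map fun q => q.dim).sum := by
    simp only [IsoClass.dim_eq_sum_character, hc, Multiset.sum_map_sum]
  have h3 : p.s (regularClass k X) = p.dim * (regularClass k X).dim := by
    rw [h1, h2, ← Multiset.sum_map_mul_left]
    exact congrArg Multiset.sum (Multiset.map_congr rfl fun q hq => hs q ((hL q).1 hq))
  obtain ⟨V, hV, rfl⟩ := hp
  exact ⟨V, hV, isTransparent_of_transparentProj (transparentProj_eq_one_of_sEntry h3), rfl⟩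

/-! ### The sum of the squared dimensions -/

variable (k X) in
open Classical in
/-- The regular object contains each simple class `p` with multiplicity `d_p`, and `τ` has trace
`d_p` on the transparent ones and `0` on the others; so `∑ d_p²` over the transparent classes is the
trace of `τ` on the regular object. -/
theorem finite_transparentClasses_and_sum [IsAlgClosed k] [CharZero k] [Fintype X₁] :
    (transparentClasses k X).Finite ∧ ∑ᶠ p ∈ transparentClasses k X, p.dim ^ 2 =
      LinearMap.trace k (regular k X).V (transparentProj (regular k X)) := by
  obtain ⟨L, hL, hcount, hc⟩ := exists_regular_decomposition k X
  have hT : transparentClasses k X =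
      ((L.toFinset.filter (· ∈ transparentClasses k X) : Finset (IsoClass k X)) : Set _) := by
    ext p
    simp only [Finset.coe_filter, Multiset.mem_toFinset, Set.mem_ofPred_eq, hL]
    exact ⟨fun h => ⟨transparentClasses_subset h, h⟩, fun h => h.2⟩
  have htr : ∀ p ∈ simpleClasses k X, (Fintype.card X₂ : k)⁻¹ *
      ∑ m with X.bdry m = 1, ∑ n, p.character m (X.bdry n) =
        if p ∈ transparentClasses k X then p.dim else 0 := by
    rintro _ ⟨V, hV, rfl⟩
    refine (trace_transparentProj V).symm.trans ((trace_transparentProj_of_simple hV).trans ?_)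
    simp only [mk_mem_transparentClasses_iff, hV, true_and]
    rfl
  have hR : LinearMap.trace k (regular k X).V (transparentProj (regular k X)) =
      (L.map fun p => if p ∈ transparentClasses k X then p.dim else 0).sum := by
    rw [← Multiset.map_congr rfl fun p hp => htr p ((hL p).1 hp), Multiset.sum_map_mul_left,
      trace_transparentProj, Multiset.sum_map_sum]
    congr 1
    refine Finset.sum_congr rfl fun m _ => ?_
    rw [Multiset.sum_map_sum]
    exact Finset.sum_congr rfl fun n _ => hc m (X.bdry n)
  refine ⟨hT ▸ Finset.finite_toSet _, ?_⟩
  rw [hR, Finset.sum_multiset_map_count, finsum_mem_congr hT fun _ _ => rfl,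
    finsum_mem_coe_finset, Finset.sum_filter]
  refine Finset.sum_congr rfl fun p hp => ?_
  rw [nsmul_eq_mul, hcount p ((hL p).1 (Multiset.mem_toFinset.1 hp)), sq, mul_ite, mul_zero]

end XRep

theorem corollary2p3 {k : Type u} [Field k] [IsAlgClosed k] [CharZero k]
    {X₁ : Type v₁} {X₂ : Type v₂} [Group X₁] [Group X₂] [Finite X₁] [Fintype X₂]
    (X : CrossedModule X₁ X₂) :
    (XRep.collinearClasses k X = XRep.transparentClasses k X ∧
      XRep.M k X = XRep.transparentClasses k X) ∧
    (∀ V : XRep k X, RibbonCategory.IsTransparent V → (RibbonCategory.twist V).hom = 𝟙 V) ∧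
    ((XRep.transparentClasses k X).Finite ∧
      ∑ᶠ p ∈ XRep.transparentClasses k X, p.dim ^ 2 =
        ((Nat.card X.bdry.ker * Nat.card (X₁ ⧸ X.bdry.range) : ℕ) : k)) := by
  cases nonempty_fintype X₁
  have hM : XRep.M k X = XRep.transparentClasses k X :=
    XRep.M_subset_transparentClasses.antisymm XRep.transparentClasses_subset_M
  obtain ⟨hfin, hsum⟩ := XRep.finite_transparentClasses_and_sum k X
  exact ⟨⟨XRep.collinearClasses_eq_M.trans hM, hM⟩,
    fun V hV => XRep.twist_eq_id_of_transparentProj ((XRep.isTransparent_iff V).1 hV),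
    hfin, hsum.trans (XRep.trace_transparentProj_regular)⟩
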